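/- Let $\mathbb K=\mathbb R$ or $\mathbb C$, let $1<p,q<\infty$, and let $X=\ell^p(\ell^q)$ be the space of all $x=(x_{j,k})_{j,k\ge1}\subset\mathbb K$ with $$\|x\|=\Big[\sum_{j}\Big(\sum_{k}|x_{j,k}|^q\Big)^{p/q}\Big]^{1/p}<\infty ,$$ with the canonical basis $\mathcal D=\{\mathbf e_{j,k}\}_{j,k\ge1}$ as dictionary. Let $p'=p/(p-1)$, $q'=q/(q-1)$ and $\beta=\max\{p'/q',\,q'/p'\}$. For $f\in X$ let $\sigma_N(f)$ be the infimum of $\|f-g\|$ over all linear combinations $g$ of at most $N$ elements of $\mathcal D$. For $\tau\in(0,1]$, the Weak Chebyshev Greedy Algorithm (WCGA) with weakness parameter $\tau$ applied to $f\in X$ starts with $\mathcal G_0=0$. Given $\mathcal G_n$ with $f_n=f-\mathcal G_n\ne0$, it takes a functional $F_{f_n}\in X^*$ with $\|F_{f_n}\|=1$ and $F_{f_n}(f_n)=\|f_n\|$, picks any $\phi_{n+1}\in\mathcal D$ with $|F_{f_n}(\phi_{n+1})|\ge\tau\sup_{\phi\in\mathcal D}|F_{f_n}(\phi)|$, and lets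 $\mathcal G_{n+1}$ be any element of $\operatorname{span}\{\phi_1,\dots,\phi_{n+1}\}$ closest to $f$; if $f_n=0$, then $\mathcal G_m=\mathcal G_n$ for all $m\ge n$. For $C>0$ and $\varphi:\mathbb N\to\mathbb N$, say that $L(\tau,C,\varphi)$ holds if $$\|f-\mathcal G_{\varphi(N)}\|\le C\,\sigma_N(f)\qquad\text{for all } N\ge1,\ f\in X,\text{ and all runs }(\mathcal G_n)_{n\ge0}\text{ of the WCGA for } f .$$ (a) There is an absolute constant $C\ge1$ such that for all $1<p,q<\infty$ and $\tau\in(0,1]$ there is $c=c(p,q,\tau)>0$ for which $L(\tau,C,\varphi)$ holds in $\ell^p(\ell^q)$ with $\varphi(N)=\lfloor cN^\beta\rfloor$. (b) Conversely, for all $1<p,q<\infty$ and $C>0$ there is $c'=c'(p,q,C)>0$ such that, for every $\tau\in(0,1]$ and every $\psi:\mathbb N\to\mathbb N$ for which $L(\tau,C,\psi)$ holds in $\ell^p(\ell^q)$, one has $\psi(N)\ge c'N^\beta$ for all $N\ge1$. -/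

import Mathlib

open scoped ENNReal

noncomputable section

section Greedy

variable (𝕜 : Type*) [RCLike 𝕜] {X : Type*} [NormedAddCommGroup X] [NormedSpace 𝕜 X] {ι : Type*}

/-- The functional `F` norms `f`: `‖F‖ = 1` and `F f = ‖f‖`. -/
def IsNormingFunctional (F : X →L[𝕜] 𝕜) (f : X) : Prop :=
  ‖F‖ = 1 ∧ F f = ((‖f‖ : ℝ) : 𝕜)

/-- The set of `N`-sparse vectors: linear combinations of at most `N` elements of the
dictionary `D`. -/
def sparseVectors (D : ι → X) (N : ℕ) : Set X :=
  {g | ∃ A : Finset ι, A.card ≤ N ∧ g ∈ Submodule.span 𝕜 (D '' (A : Set ι))}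

/-- The error of best `N`-term approximation, `inf {‖f - g‖ : g is N-sparse}`. -/
def bestApproxError (D : ι → X) (N : ℕ) (f : X) : ℝ :=
  Metric.infDist f (sparseVectors 𝕜 D N)

/-- The linear span of the dictionary elements `D (i 0), …, D (i n)`. -/
def chosenSpan (D : ι → X) (i : ℕ → ι) (n : ℕ) : Submodule 𝕜 X :=
  Submodule.span 𝕜 ((fun k => D (i k)) '' Set.Iic n)

/-- `(i, G)` is a run of the Weak Chebyshev Greedy Algorithm for `f`, with dictionary `D` and
weakness parameter `τ`: the element selected at step `n + 1` is `D (i n)`, and `G n` is the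
approximant after `n` steps. A run that reaches the remainder `0` stops there and is continued by a
constant sequence of approximants (the indices `i n` are then irrelevant). -/
structure IsWCGARun (D : ι → X) (τ : ℝ) (f : X) (i : ℕ → ι) (G : ℕ → X) : Prop where
  init : G 0 = 0
  greedy : ∀ n, f - G n ≠ 0 → ∃ F : X →L[𝕜] 𝕜, IsNormingFunctional 𝕜 F (f - G n) ∧
    ∀ j, τ * ‖F (D j)‖ ≤ ‖F (D (i n))‖
  mem_span : ∀ n, f - G n ≠ 0 → G (n + 1) ∈ chosenSpan 𝕜 D i n
  chebyshev : ∀ n, f - G n ≠ 0 →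
    ‖f - G (n + 1)‖ = Metric.infDist f (chosenSpan 𝕜 D i n : Set X)
  terminal : ∀ n, f - G n = 0 → G (n + 1) = G n

/-- The Lebesgue-type inequality `‖f - G_{φ(N)}(f)‖ ≤ C σ_N(f)`, for all `N ≥ 1`, all `f` and every
run of the algorithm for `f`. -/
def WCGALebesgueInequality (D : ι → X) (τ C : ℝ) (φ : ℕ → ℕ) : Prop :=
  ∀ N : ℕ, 1 ≤ N → ∀ (f : X) (i : ℕ → ι) (G : ℕ → X), IsWCGARun 𝕜 D τ f i G →
    ‖f - G (φ N)‖ ≤ C * bestApproxError 𝕜 D N f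

end Greedy

section MixedSpace

variable (𝕜 : Type*) [RCLike 𝕜] (p q : ℝ≥0∞)

/-- The mixed-norm sequence space `ℓ^p(ℓ^q)` of double sequences `x j k`, with the norm
`(∑ j, (∑ k, |x j k| ^ q) ^ (p / q)) ^ (1 / p)`. -/
abbrev MixedLp [Fact (1 ≤ q)] : Type _ :=
  lp (fun _ : ℕ => lp (fun _ : ℕ => 𝕜) q) p

/-- The canonical basis of `ℓ^p(ℓ^q)`. -/
def canonicalBasis [Fact (1 ≤ q)] (jk : ℕ × ℕ) : MixedLp 𝕜 p q :=
  lp.single p jk.1 (lp.single q jk.2 (1 : 𝕜))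

/-- `β(p, q) = max {p' / q', q' / p'}`, where `p' = p / (p - 1)` and `q' = q / (q - 1)`. -/
def wcgaExponent : ℝ :=
  max (Real.conjExponent p.toReal / Real.conjExponent q.toReal)
    (Real.conjExponent q.toReal / Real.conjExponent p.toReal)

end MixedSpace

end

/-!
In `ℓ^p(ℓ^q)` the best approximation from a span of basis vectors is a coordinate projection, so the
residuals of the algorithm are the vectors `f` with the selected coordinates set to zero
(`IsWCGARun.sub_eq_zeroOn`). A norming functional `F` of `f` satisfies
`‖F e_{j,k}‖ ‖f‖^{p-1} = ‖f j‖^{p-q} |f j k|^{q-1}` (`norm_apply_canonicalBasis`). Two facts follow: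
with `t = ‖F e‖` and `y` the coordinate of `f` at `e` divided by `‖f‖`,
`y^{max(p,q)-1} ≤ t ≤ y^{min(p,q)-1}`, and setting the coordinate at `e` to zero multiplies
`‖f‖^p` by at most `1 - min(1, p/q) t y`.

*Upper bound.* Let `r` and `s` be the conjugate exponents of `min(p,q)` and `max(p,q)`, so that
`β = r / s`. If `M` coordinates carry half of the norm of the residual, then `∑ t y ≥ 1/2` over
these coordinates, and `t y ≤ t^s` forces `t ≥ (2M)^{-1/s}` for one of them. The selected vector has
a `t` at least `τ` times as large and gains `t y ≥ t^r`, which is at least of order `M^{-β}`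
(`norm_rpow_zeroOn_greedy_le`). So `O(M^β)` steps divide the residual by sixteen, as long as those
coordinates carry half of it (`exists_steps_le_max`). To avoid a logarithmic
loss, these rounds are run for `M = 1, 2, 4, …` with optimal subsets of the `N` target coordinates.
The current residual stays comparable to the best one, unless the best residual drops sharply when
`M` doubles. In that case the current residual falls below a quarter of the best residual for
`2^j - 1` target coordinates, which is only possible if `2^j` of them have been selected, within
`O(2^{jβ})` steps (`residual_le_or_many_selected`). Induction on the number of missing target
coordinates, with `a^β + b^β ≤ (a + b)^β`, gives `O(N^β)` steps in total
(`exists_steps_residual_le`).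

*Lower bound.* The two power inequalities above are sharp for entries that share one row and for
entries alone in their rows. Combining a block of `N` equal entries of norm one of one kind with
about `N^β` equal entries of the other kind and of small norm, the weights can be arranged so that
the small block is selected first (`lower_bound_of_le`, `lower_bound_of_ge`). A run exists for every
finitely supported vector since the norming functional vanishes off the support
(`exists_isWCGARun`).
-/

/-! ### Greedy selection and decay of residuals -/

section Selection

variable {ι : Type*} [DecidableEq ι]

theorem exists_subset_card_le_forall_le (N : Finset ι → ℝ) (A B : Finset ι) (m : ℕ) :
    ∃ T ⊆ B, T.card ≤ m ∧ ∀ S ⊆ B, S.card ≤ m → N (T ∪ A) ≤ N (S ∪ A) := by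
  obtain ⟨T, hT, hmin⟩ := Finset.exists_min_image
    (B.powerset.filter (fun S => S.card ≤ m)) (fun S => N (S ∪ A)) ⟨∅, by simp⟩
  simp only [Finset.mem_filter, Finset.mem_powerset] at hT hmin
  exact ⟨T, hT.1, hT.2, fun S hS hSm => hmin S ⟨hS, hSm⟩⟩

/-- If every step at which `T` captures half of the residual shrinks its `P`-th power by the factor
`1 - c M^{-β}`, then after `O(M^β)` steps the residual is comparable to the one with `T` removed, or
is sixteen times smaller. -/
theorem exists_steps_le_max {N : Finset ι → ℝ} {A : ℕ → Finset ι} {β c P : ℝ}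
    (hβ : 0 ≤ β) (hc : 0 < c) (hP : 0 < P) (hN : ∀ Y, 0 ≤ N Y)
    (hanti : ∀ Y Z, Y ⊆ Z → N Z ≤ N Y) (hA : Monotone A)
    (hstep : ∀ (k M : ℕ) (T : Finset ι), 1 ≤ M → T.card ≤ M → N (A k ∪ T) ≤ N (A k) / 2 →
      N (A (k + 1)) ^ P ≤ (1 - c * (M : ℝ) ^ (-β)) * N (A k) ^ P)
    (k M : ℕ) (T : Finset ι) (hM : 1 ≤ M) (hT : T.card ≤ M) :
    ∃ L : ℕ, (L : ℝ) ≤ (P * Real.log 16 / c + 1) * (M : ℝ) ^ β ∧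
      N (A (k + L)) ≤ max (2 * N (A k ∪ T)) (N (A k) / 16) := by
  have hM1 : (1 : ℝ) ≤ M := by exact_mod_cast hM
  have hM0 : (0 : ℝ) < M := by linarith
  have hMβ : 1 ≤ (M : ℝ) ^ β := Real.one_le_rpow hM1 hβ
  have hlog : 0 < Real.log 16 := Real.log_pos (by norm_num)
  refine ⟨⌈P * Real.log 16 / c * (M : ℝ) ^ β⌉₊, ?_, ?_⟩
  · have := (Nat.ceil_lt_add_one (a := P * Real.log 16 / c * (M : ℝ) ^ β) (by positivity)).le
    linarith
  set L := ⌈P * Real.log 16 / c * (M : ℝ) ^ β⌉₊ with hL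
  by_contra! hlt
  obtain ⟨h1, h2⟩ := max_lt_iff.1 hlt
  have key : ∀ i ≤ L, N (A (k + i)) ^ P
      ≤ Real.exp (-(c * (M : ℝ) ^ (-β)) * i) * N (A k) ^ P := by
    intro i
    induction i with
    | zero => intro _; simp
    | succ i ih =>
      intro hi
      have hhalf : N (A (k + i) ∪ T) ≤ N (A (k + i)) / 2 := by
        have e1 : N (A (k + L)) ≤ N (A (k + i)) := hanti _ _ (hA (by omega))
        have e2 : N (A (k + i) ∪ T) ≤ N (A k ∪ T) :=
          hanti _ _ (Finset.union_subset_union (hA (by omega)) subset_rfl)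
        linarith
      have e3 := hstep (k + i) M T hM hT hhalf
      have e4 : 1 - c * (M : ℝ) ^ (-β) ≤ Real.exp (-(c * (M : ℝ) ^ (-β))) := by
        have := Real.add_one_le_exp (-(c * (M : ℝ) ^ (-β)))
        linarith
      calc N (A (k + (i + 1))) ^ P ≤ (1 - c * (M : ℝ) ^ (-β)) * N (A (k + i)) ^ P := e3
        _ ≤ Real.exp (-(c * (M : ℝ) ^ (-β))) * N (A (k + i)) ^ P := by
            gcongr; exact Real.rpow_nonneg (hN _) _
        _ ≤ Real.exp (-(c * (M : ℝ) ^ (-β)))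
              * (Real.exp (-(c * (M : ℝ) ^ (-β)) * i) * N (A k) ^ P) := by
            gcongr; exact ih (by omega)
        _ = _ := by
            rw [← mul_assoc, ← Real.exp_add]; push_cast; ring_nf
  have hfin := key L le_rfl
  have hexp : Real.exp (-(c * (M : ℝ) ^ (-β)) * L) ≤ (16 : ℝ) ^ (-P) := by
    rw [Real.rpow_def_of_pos (by norm_num : (0 : ℝ) < 16)]
    apply Real.exp_le_exp.2
    have h3 : P * Real.log 16 / c * (M : ℝ) ^ β ≤ L := Nat.le_ceil _
    have h4 : c * (M : ℝ) ^ (-β) * (P * Real.log 16 / c * (M : ℝ) ^ β) = P * Real.log 16 := by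
      rw [Real.rpow_neg hM0.le]; field_simp
    have h5 : c * (M : ℝ) ^ (-β) * (P * Real.log 16 / c * (M : ℝ) ^ β)
        ≤ c * (M : ℝ) ^ (-β) * L := by gcongr
    linarith
  have hle : N (A (k + L)) ^ P ≤ (N (A k) / 16) ^ P := by
    rw [Real.div_rpow (hN _) (by norm_num), div_eq_mul_inv, ← Real.rpow_neg (by norm_num), mul_comm]
    refine hfin.trans ?_
    gcongr
    exact Real.rpow_nonneg (hN _) _
  have := Real.rpow_lt_rpow (by have := hN (A k); positivity) h2 hP
  linarith

/-- Either the residual falls, within `O((2^l)^β)` steps, below four times the best residual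
obtained by removing `2^l - 1` elements of `B`, or already within `O((2^j)^β)` steps, for some `j`,
the selection has hit `2^j` elements of `B`. -/
theorem residual_le_or_many_selected {N : Finset ι → ℝ} {A : ℕ → Finset ι} {β K : ℝ}
    (hβ : 1 ≤ β) (hK : 0 ≤ K) (hN : ∀ Y, 0 ≤ N Y)
    (hanti : ∀ Y Z, Y ⊆ Z → N Z ≤ N Y)
    (hsub : ∀ Y Y₁ Y₂, Y₁ ∩ Y₂ ⊆ Y → N Y ≤ N Y₁ + N Y₂) (hA : Monotone A)
    (hdec : ∀ (k M : ℕ) (T : Finset ι), 1 ≤ M → T.card ≤ M → ∃ L : ℕ,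
      (L : ℝ) ≤ K * (M : ℝ) ^ β ∧ N (A (k + L)) ≤ max (2 * N (A k ∪ T)) (N (A k) / 16))
    (k : ℕ) (B : Finset ι) (T : ℕ → Finset ι) (hTB : ∀ l, T l ⊆ B)
    (hTc : ∀ l, (T l).card ≤ 2 ^ l - 1)
    (hTm : ∀ l, ∀ S ⊆ B, S.card ≤ 2 ^ l - 1 → N (T l ∪ A k) ≤ N (S ∪ A k)) (l : ℕ) :
    (∃ L : ℕ, (L : ℝ) ≤ 2 * K * ((2 : ℝ) ^ l) ^ β ∧ N (A (k + L)) ≤ 4 * N (T l ∪ A k)) ∨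
    (∃ j L : ℕ, (L : ℝ) ≤ 2 * K * ((2 : ℝ) ^ (j + 1)) ^ β ∧
      2 ^ j ≤ (B ∩ A (k + L)).card) := by
  induction l with
  | zero =>
    left
    have : T 0 = ∅ := by simpa using hTc 0
    refine ⟨0, by simpa using hK, ?_⟩
    have h0 := hN (A k)
    simp only [this, Finset.empty_union, add_zero]
    linarith
  | succ l ih =>
    rcases ih with ⟨L, hL, hNL⟩ | h
    swap
    · exact Or.inr h
    have hp : 1 ≤ 2 ^ l := Nat.one_le_two_pow
    obtain ⟨L', hL', hNL'⟩ := hdec (k + L) (2 ^ (l + 1)) (T (l + 1)) Nat.one_le_two_pow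
      ((hTc _).trans (Nat.sub_le _ _))
    have hLL : ((L + L' : ℕ) : ℝ) ≤ 2 * K * ((2 : ℝ) ^ (l + 1)) ^ β := by
      have h2 : (2 : ℝ) ≤ 2 ^ β := by
        simpa using Real.rpow_le_rpow_of_exponent_le (x := 2) (by norm_num) hβ
      have h3 : 2 * ((2 : ℝ) ^ l) ^ β ≤ ((2 : ℝ) ^ (l + 1)) ^ β := by
        rw [pow_succ, Real.mul_rpow (by positivity) (by positivity), mul_comm]
        gcongr
      push_cast at hL' ⊢
      nlinarith
    have hT' : N (A (k + L) ∪ T (l + 1)) ≤ N (T (l + 1) ∪ A k) := by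
      apply hanti
      rw [Finset.union_comm]
      exact Finset.union_subset_union (hA (by omega)) subset_rfl
    rw [add_assoc] at hNL'
    have hν0 := hN (T (l + 1) ∪ A k)
    have hB : N (B ∪ A k) ≤ N (T (l + 1) ∪ A k) :=
      hanti _ _ (Finset.union_subset_union (hTB _) subset_rfl)
    by_cases hcmp : N (T l ∪ A k) ≤ 16 * N (T (l + 1) ∪ A k)
    · left
      refine ⟨L + L', hLL, hNL'.trans (max_le ?_ ?_)⟩ <;> linarith
    · right
      refine ⟨l, L + L', hLL, ?_⟩
      by_contra! hfew
      push Not at hcmp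
      -- If few elements were hit, the optimality of `T l` bounds its residual by the current one.
      have h1 : N (T l ∪ A k) ≤ N ((B ∩ A (k + (L + L'))) ∪ A k) :=
        hTm l _ Finset.inter_subset_left (by omega)
      have h2 : N ((B ∩ A (k + (L + L'))) ∪ A k) ≤ N (A (k + (L + L'))) + N (B ∪ A k) := by
        apply hsub
        intro e he
        simp only [Finset.mem_inter, Finset.mem_union] at he ⊢
        tauto
      have h3 : N (A (k + (L + L'))) ≤ N (T l ∪ A k) / 4 := by
        refine hNL'.trans (max_le ?_ ?_) <;> linarith
      linarith

/-- A selection satisfying the decay estimate `hdec` brings the residual below four times the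
residual of `B` in a number of steps of order `n^β`, where `n` counts the elements of `B` that are
still missing. -/
theorem exists_steps_residual_le {N : Finset ι → ℝ} {A : ℕ → Finset ι} {β K : ℝ}
    (hβ : 1 ≤ β) (hK : 0 ≤ K) (hN : ∀ Y, 0 ≤ N Y)
    (hanti : ∀ Y Z, Y ⊆ Z → N Z ≤ N Y)
    (hsub : ∀ Y Y₁ Y₂, Y₁ ∩ Y₂ ⊆ Y → N Y ≤ N Y₁ + N Y₂) (hA : Monotone A)
    (hdec : ∀ (k M : ℕ) (T : Finset ι), 1 ≤ M → T.card ≤ M → ∃ L : ℕ,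
      (L : ℝ) ≤ K * (M : ℝ) ^ β ∧ N (A (k + L)) ≤ max (2 * N (A k ∪ T)) (N (A k) / 16))
    (B : Finset ι) (n k : ℕ) (hn : (B \ A k).card = n) :
    ∃ L : ℕ, (L : ℝ) ≤ 2 * K * 2 ^ β * (n : ℝ) ^ β ∧ N (A (k + L)) ≤ 4 * N B := by
  induction n using Nat.strong_induction_on generalizing k with
  | _ n ih =>
  rcases Nat.eq_zero_or_pos n with rfl | hpos
  · refine ⟨0, by simp [Real.zero_rpow (by linarith : β ≠ 0)], ?_⟩
    have : B ⊆ A k := by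
      rw [Finset.card_eq_zero] at hn
      exact Finset.sdiff_eq_empty_iff_subset.1 hn
    have h1 := hanti _ _ this
    have h2 := hN B
    simp only [add_zero]
    linarith
  set B' := B \ A k with hB'
  choose T hTB hTc hTm using
    fun l : ℕ => exists_subset_card_le_forall_le N (A k) B' (2 ^ l - 1)
  have hlog : n < 2 ^ (Nat.log 2 n + 1) := Nat.lt_pow_succ_log_self (by norm_num) n
  have hlog' : 2 ^ Nat.log 2 n ≤ n := Nat.pow_log_le_self 2 hpos.ne'
  rcases residual_le_or_many_selected hβ hK hN hanti hsub hA hdec k B' T hTB hTc hTm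
    (Nat.log 2 n + 1) with ⟨L, hL, hNL⟩ | ⟨j, L, hL, hj⟩
  · refine ⟨L, hL.trans ?_, hNL.trans ?_⟩
    · rw [mul_assoc (2 * K), ← Real.mul_rpow (by norm_num) (by positivity)]
      gcongr
      rw [pow_succ, mul_comm]
      gcongr
      exact_mod_cast hlog'
    · gcongr
      refine (hTm _ B' subset_rfl (by omega)).trans (hanti _ _ ?_)
      intro e he
      by_cases h : e ∈ A k <;> simp [hB', h, he]
  · set r := (B' ∩ A (k + L)).card with hr
    have hr1 : 1 ≤ r := Nat.one_le_two_pow.trans hj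
    have hcard : (B \ A (k + L)).card + r = n := by
      have : B \ A (k + L) = B' \ A (k + L) := by
        ext e
        simp only [hB', Finset.mem_sdiff]
        have : e ∈ A k → e ∈ A (k + L) := fun h => hA (Nat.le_add_right k L) h
        tauto
      rw [this, hr, Finset.card_sdiff_add_card_inter, hn]
    obtain ⟨L', hL', hN'⟩ := ih _ (by omega) (k + L) rfl
    refine ⟨L + L', ?_, by rwa [← add_assoc]⟩
    have hL2 : (L : ℝ) ≤ 2 * K * 2 ^ β * (r : ℝ) ^ β := by
      refine hL.trans ?_
      rw [mul_assoc (2 * K), ← Real.mul_rpow (by norm_num) (by positivity)]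
      gcongr
      rw [pow_succ, mul_comm]
      gcongr
      exact_mod_cast hj
    have hadd : (r : ℝ) ^ β + ((B \ A (k + L)).card : ℝ) ^ β ≤ (n : ℝ) ^ β := by
      have h := NNReal.add_rpow_le_rpow_add (r : NNReal) ((B \ A (k + L)).card : NNReal) hβ
      have h' : ((r : NNReal) : ℝ) + (((B \ A (k + L)).card : NNReal) : ℝ) = n := by
        rw [← hcard]; push_cast; ring
      have h2 := NNReal.coe_le_coe.2 h
      push_cast at h2 h'
      rwa [h'] at h2
    calc ((L + L' : ℕ) : ℝ) = L + L' := by push_cast; ring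
      _ ≤ 2 * K * 2 ^ β * ((r : ℝ) ^ β + ((B \ A (k + L)).card : ℝ) ^ β) := by
          rw [mul_add]; exact add_le_add hL2 hL'
      _ ≤ _ := by gcongr

end Selection

/-! ### The norm of `ℓ^p(ℓ^q)` coordinate by coordinate -/

section MixedNorm

theorem lp.norm_rpow_add_norm_rpow_of_eqOn_compl {α : Type*} {E : α → Type*}
    [∀ i, NormedAddCommGroup (E i)] {p : ℝ≥0∞} (hp : 0 < p.toReal) (f g : lp E p) (i : α)
    (h : ∀ j, j ≠ i → g j = f j) :
    ‖g‖ ^ p.toReal + ‖f i‖ ^ p.toReal = ‖f‖ ^ p.toReal + ‖g i‖ ^ p.toReal := by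
  classical
  have h1 := lp.norm_sub_norm_compl_sub_single hp f {i}
  have h2 := lp.norm_sub_norm_compl_sub_single hp g {i}
  simp only [Finset.sum_singleton] at h1 h2
  have h3 : f - lp.single p i (f i) = g - lp.single p i (g i) := by
    ext j
    by_cases hj : j = i
    · subst hj; simp
    · simp [Pi.single_eq_of_ne hj, h j hj]
  rw [h3] at h1
  linarith

variable {𝕜 : Type*} [RCLike 𝕜] {p q : ℝ≥0∞} [Fact (1 ≤ q)]

/-- The coordinate functional `x ↦ x j k` on `ℓ^p(ℓ^q)`. -/
noncomputable def coord (e : ℕ × ℕ) : MixedLp 𝕜 p q →ₗ[𝕜] 𝕜 where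
  toFun f := f e.1 e.2
  map_add' _ _ := rfl
  map_smul' _ _ := rfl

theorem coord_apply (e : ℕ × ℕ) (f : MixedLp 𝕜 p q) : coord e f = f e.1 e.2 := rfl

theorem MixedLp.ext_coord {f g : MixedLp 𝕜 p q} (h : ∀ e, coord e f = coord e g) : f = g := by
  ext j k
  exact h (j, k)

theorem coord_canonicalBasis (e e' : ℕ × ℕ) :
    coord e (canonicalBasis 𝕜 p q e') = if e = e' then 1 else 0 := by
  obtain ⟨j, k⟩ := e
  obtain ⟨j', k'⟩ := e'
  rw [coord_apply, canonicalBasis]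
  by_cases hj : j = j'
  · subst hj
    by_cases hk : k = k'
    · subst hk; simp
    · simp [hk]
  · simp [hj]

theorem norm_coord_le (f : MixedLp 𝕜 p q) (e : ℕ × ℕ) : ‖coord e f‖ ≤ ‖f e.1‖ :=
  lp.norm_apply_le_norm (zero_lt_one.trans_le (Fact.out : 1 ≤ q)).ne' _ _

/-- How the norm responds to a change of the single coordinate `e`. -/
theorem norm_rpow_of_coord_eq (hp : 0 < p.toReal) (hq : 0 < q.toReal) {f g : MixedLp 𝕜 p q}
    (e : ℕ × ℕ) (h : ∀ e', e' ≠ e → coord e' g = coord e' f) :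
    ‖g‖ ^ p.toReal = ‖f‖ ^ p.toReal - ‖f e.1‖ ^ p.toReal +
      (‖f e.1‖ ^ q.toReal - ‖coord e f‖ ^ q.toReal + ‖coord e g‖ ^ q.toReal)
        ^ (p.toReal / q.toReal) := by
  have h1 := lp.norm_rpow_add_norm_rpow_of_eqOn_compl hp f g e.1 fun j hj => by
    ext k
    exact h (j, k) fun he => hj (by rw [← he])
  have h2 := lp.norm_rpow_add_norm_rpow_of_eqOn_compl hq (f e.1) (g e.1) e.2 fun k hk =>
    h (e.1, k) fun he => hk (by rw [← he])
  rw [coord_apply, coord_apply]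
  have h3 : ‖f e.1‖ ^ q.toReal - ‖f e.1 e.2‖ ^ q.toReal + ‖g e.1 e.2‖ ^ q.toReal
      = ‖g e.1‖ ^ q.toReal := by linarith
  rw [h3, ← Real.rpow_mul (norm_nonneg _), mul_div_cancel₀ _ hq.ne']
  linarith

theorem norm_row_rpow_eq_sum (hq : 0 < q.toReal) (f : MixedLp 𝕜 p q) (j : ℕ) {S : Finset ℕ}
    (hS : ∀ k ∉ S, coord (j, k) f = 0) :
    ‖f j‖ ^ q.toReal = ∑ k ∈ S, ‖coord (j, k) f‖ ^ q.toReal := by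
  rw [lp.norm_rpow_eq_tsum hq]
  refine tsum_eq_sum fun k hk => ?_
  have : f j k = 0 := hS k hk
  rw [this, norm_zero, Real.zero_rpow hq.ne']

variable [Fact (1 ≤ p)]

theorem norm_le_of_norm_coord_le {f g : MixedLp 𝕜 p q}
    (h : ∀ e, ‖coord e f‖ ≤ ‖coord e g‖) : ‖f‖ ≤ ‖g‖ := by
  have hp : p ≠ 0 := (zero_lt_one.trans_le (Fact.out : 1 ≤ p)).ne'
  have hq : q ≠ 0 := (zero_lt_one.trans_le (Fact.out : 1 ≤ q)).ne'
  exact lp.norm_mono hp fun j => lp.norm_mono hq fun k => h (j, k)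

theorem norm_row_le (f : MixedLp 𝕜 p q) (j : ℕ) : ‖f j‖ ≤ ‖f‖ :=
  lp.norm_apply_le_norm (zero_lt_one.trans_le (Fact.out : 1 ≤ p)).ne' _ _

/-! ### Norming functionals -/

theorem nonneg_of_hasDerivAt_of_nonneg_right {φ : ℝ → ℝ} {d : ℝ} (hφ : HasDerivAt φ d 0)
    (h0 : φ 0 = 0) (h : ∀ᶠ s in nhdsWithin 0 (Set.Ioi 0), 0 ≤ φ s) : 0 ≤ d := by
  have h1 := hφ.hasDerivWithinAt (s := Set.Ioi 0)
  rw [hasDerivWithinAt_iff_tendsto_slope' (by simp)] at h1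
  refine ge_of_tendsto h1 ?_
  filter_upwards [h, self_mem_nhdsWithin] with s hs hs0
  have : (0 : ℝ) < s := hs0
  simp only [slope_def_field, h0, sub_zero]
  positivity

/-- First-order condition at `s = 0` for a line that supports the norm along a coordinate. -/
theorem slope_eq_of_support {ρ t a x P Q : ℝ} (hP : 1 < P) (hQ : 1 < Q) (hρ : 0 < ρ)
    (ht : 0 ≤ t) (hx : 0 ≤ x) (hxa : x ≤ a)
    (H : ∀ s, -x ≤ s → 0 ≤ ρ + s * t →
      (ρ + s * t) ^ P ≤ ρ ^ P - a ^ P + (a ^ Q - x ^ Q + (x + s) ^ Q) ^ (P / Q)) :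
    t * ρ ^ (P - 1) = a ^ (P - Q) * x ^ (Q - 1) := by
  have hnear : ∀ᶠ s in nhds (0 : ℝ), 0 ≤ ρ + s * t := by
    have : Filter.Tendsto (fun s : ℝ => ρ + s * t) (nhds 0) (nhds (ρ + 0 * t)) := by
      apply Continuous.tendsto; fun_prop
    filter_upwards [this.eventually (lt_mem_nhds (by simpa using hρ : 0 < ρ + 0 * t))] with s hs
    exact hs.le
  have hlin : HasDerivAt (fun s : ℝ => (ρ + s * t) ^ P) (t * P * ρ ^ (P - 1)) 0 := by
    have h1 : HasDerivAt (fun s : ℝ => ρ + s * t) t 0 := by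
      simpa using ((hasDerivAt_id (0 : ℝ)).mul_const t).const_add ρ
    simpa using h1.rpow_const (p := P) (Or.inr hP.le)
  have hPpos : 0 < P := by linarith
  have hQpos : 0 < Q := by linarith
  have hρP : 0 ≤ t * ρ ^ (P - 1) := mul_nonneg ht (Real.rpow_nonneg hρ.le _)
  -- On a zero row the inner power is not differentiable, but the composite is `s ^ P`. When `x = 0`
  -- only `s ≥ 0` is admissible, and a one-sided derivative suffices as both sides vanish.
  rcases (hx.trans hxa).eq_or_lt with ha | ha
  · have hx0 : x = 0 := by linarith
    subst hx0
    subst ha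
    have h0Q : (0 : ℝ) ^ (Q - 1) = 0 := Real.zero_rpow (by linarith)
    have h0P : (0 : ℝ) ^ (P - 1) = 0 := Real.zero_rpow (by linarith)
    have hd : HasDerivAt (fun s : ℝ => ρ ^ P + s ^ P - (ρ + s * t) ^ P)
        (P * 0 ^ (P - 1) - t * P * ρ ^ (P - 1)) 0 :=
      ((Real.hasDerivAt_rpow_const (Or.inr hP.le)).const_add _).sub hlin
    have := nonneg_of_hasDerivAt_of_nonneg_right hd (by simp [Real.zero_rpow hPpos.ne']) ?_
    · rw [h0P] at this
      rw [h0Q]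
      nlinarith
    · filter_upwards [nhdsWithin_le_nhds hnear, self_mem_nhdsWithin] with s hs hs0
      have hs0' : (0 : ℝ) < s := hs0
      have := H s (by linarith) hs
      simp only [Real.zero_rpow hPpos.ne', Real.zero_rpow hQpos.ne', sub_zero, zero_add] at this
      rw [← Real.rpow_mul hs0'.le, mul_div_cancel₀ _ hQpos.ne'] at this
      linarith
  · have hd : HasDerivAt (fun s : ℝ => ρ ^ P - a ^ P + (a ^ Q - x ^ Q + (x + s) ^ Q) ^ (P / Q)
        - (ρ + s * t) ^ P) (P * (a ^ (P - Q) * x ^ (Q - 1) - t * ρ ^ (P - 1))) 0 := by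
      have h1 : HasDerivAt (fun s : ℝ => x + s) 1 0 := by
        simpa using (hasDerivAt_id (0 : ℝ)).const_add x
      have h2 := h1.rpow_const (p := Q) (Or.inr hQ.le)
      have h3 := h2.const_add (a ^ Q - x ^ Q)
      have haQ : 0 < a ^ Q := Real.rpow_pos_of_pos ha _
      have h4 := h3.rpow_const (p := P / Q) (Or.inl (by simp; exact haQ.ne'))
      have h5 := (h4.const_add (ρ ^ P - a ^ P)).sub hlin
      refine h5.congr_deriv ?_
      have h6 : (a ^ Q) ^ (P / Q - 1) = a ^ (P - Q) := by
        rw [← Real.rpow_mul ha.le]; congr 1; field_simp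
      simp only [add_zero, sub_add_cancel, h6]
      field_simp
    have hφ0 : ρ ^ P - a ^ P + (a ^ Q - x ^ Q + (x + 0) ^ Q) ^ (P / Q) - (ρ + 0 * t) ^ P = 0 := by
      have : (a ^ Q) ^ (P / Q) = a ^ P := by
        rw [← Real.rpow_mul ha.le]; congr 1; field_simp
      simp [this]
    rcases hx.eq_or_lt with hx0 | hx0
    · subst hx0
      have h0Q : (0 : ℝ) ^ (Q - 1) = 0 := Real.zero_rpow (by linarith)
      have := nonneg_of_hasDerivAt_of_nonneg_right hd hφ0 ?_
      · rw [h0Q] at this ⊢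
        nlinarith
      · filter_upwards [nhdsWithin_le_nhds hnear, self_mem_nhdsWithin] with s hs hs0
        have hs0' : (0 : ℝ) < s := hs0
        have := H s (by linarith) hs
        linarith
    · have hmin : IsLocalMin (fun s : ℝ => ρ ^ P - a ^ P
          + (a ^ Q - x ^ Q + (x + s) ^ Q) ^ (P / Q) - (ρ + s * t) ^ P) 0 := by
        filter_upwards [hnear, lt_mem_nhds (show -x < 0 by linarith)] with s hs hs1
        rw [hφ0]
        have := H s hs1.le hs
        linarith
      have := hmin.hasDerivAt_eq_zero hd
      have h7 : a ^ (P - Q) * x ^ (Q - 1) - t * ρ ^ (P - 1) = 0 := by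
        rcases mul_eq_zero.1 this with h | h
        · linarith
        · exact h
      linarith

/-- The modulus of a norming functional of `f` at the basis vector `e`: the functional is
determined on the basis by the norm of `f`, the norm of the row of `e`, and the coordinate of `f`
at `e`. -/
theorem norm_apply_canonicalBasis (hp : 1 < p.toReal) (hq : 1 < q.toReal) {f : MixedLp 𝕜 p q}
    (hf : f ≠ 0) {F : MixedLp 𝕜 p q →L[𝕜] 𝕜} (hF : IsNormingFunctional 𝕜 F f) (e : ℕ × ℕ) :
    ‖F (canonicalBasis 𝕜 p q e)‖ * ‖f‖ ^ (p.toReal - 1)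
      = ‖f e.1‖ ^ (p.toReal - q.toReal) * ‖coord e f‖ ^ (q.toReal - 1) := by
  refine slope_eq_of_support hp hq (norm_pos_iff.2 hf) (norm_nonneg _) (norm_nonneg _)
    (norm_coord_le f e) ?_
  intro s hs hpos
  set D := canonicalBasis 𝕜 p q e with hD
  -- A perturbation along `D` whose coordinate grows by at most `s`, yet whose image under `F`
  -- changes by at least `s ‖F D‖`.
  obtain ⟨z, hz1, hz2⟩ : ∃ z : 𝕜, ‖coord e f + z‖ ≤ ‖coord e f‖ + s ∧
      ‖f‖ + s * ‖F D‖ ≤ ‖F (f + z • D)‖ := by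
    simp only [map_add, map_smul, smul_eq_mul, hF.2]
    rcases le_or_gt 0 s with h0 | h0
    · obtain ⟨c, hc1, hc2⟩ := RCLike.exists_norm_eq_mul_self (F D)
      refine ⟨(s : 𝕜) * c, ?_, ?_⟩
      · refine (norm_add_le _ _).trans ?_
        rw [norm_mul, hc1, RCLike.norm_ofReal, abs_of_nonneg h0, mul_one]
      · rw [mul_assoc, ← hc2, ← RCLike.ofReal_mul, ← RCLike.ofReal_add, RCLike.norm_ofReal]
        exact le_abs_self _
    · have hx : 0 < ‖coord e f‖ := by linarith
      refine ⟨((s / ‖coord e f‖ : ℝ) : 𝕜) * coord e f, ?_, ?_⟩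
      · have h1 : coord e f + ((s / ‖coord e f‖ : ℝ) : 𝕜) * coord e f
            = ((1 + s / ‖coord e f‖ : ℝ) : 𝕜) * coord e f := by push_cast; ring
        rw [h1, norm_mul, RCLike.norm_ofReal, abs_of_nonneg]
        · apply le_of_eq; field_simp
        · rw [← sub_nonneg] at hs
          have : 1 + s / ‖coord e f‖ = (s - -‖coord e f‖) / ‖coord e f‖ := by field_simp; ring
          rw [this]; positivity
      · have h1 := norm_sub_le_norm_add ((‖f‖ : ℝ) : 𝕜)
          (((s / ‖coord e f‖ : ℝ) : 𝕜) * coord e f * F D)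
        refine le_trans (le_of_eq ?_) h1
        rw [norm_mul, norm_mul, RCLike.norm_ofReal, RCLike.norm_ofReal, abs_norm, abs_div,
          abs_norm, abs_of_neg h0]
        field_simp
        ring
  have hle : ‖f‖ + s * ‖F D‖ ≤ ‖f + z • D‖ := by
    refine hz2.trans ((F.le_opNorm _).trans ?_)
    rw [hF.1, one_mul]
  have hP0 : 0 < p.toReal := by linarith
  have hQ0 : 0 < q.toReal := by linarith
  have hxa := Real.rpow_le_rpow (norm_nonneg _) (norm_coord_le f e) hQ0.le
  have h1 := norm_rpow_of_coord_eq hP0 hQ0 (f := f) (g := f + z • D) e fun e' he' => by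
    simp [hD, coord_canonicalBasis, he']
  have h2 : coord e (f + z • D) = coord e f + z := by simp [hD, coord_canonicalBasis]
  rw [h2] at h1
  calc (‖f‖ + s * ‖F D‖) ^ p.toReal ≤ ‖f + z • D‖ ^ p.toReal := by gcongr
    _ = _ := h1
    _ ≤ _ := by
      have : 0 ≤ ‖coord e f + z‖ ^ q.toReal := by positivity
      gcongr

theorem one_sub_rpow_le {u θ : ℝ} (hu0 : 0 ≤ u) (hu1 : u ≤ 1) (hθ : 0 ≤ θ) :
    (1 - u) ^ θ ≤ 1 - min 1 θ * u := by
  rcases le_total 1 θ with h | h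
  · rw [min_eq_left h, one_mul]
    exact Real.rpow_le_self_of_le_one (by linarith) (by linarith) h
  · rw [min_eq_right h]
    have := rpow_one_add_le_one_add_mul_self (s := -u) (by linarith) hθ h
    rw [← sub_eq_add_neg] at this
    linarith

theorem sub_rpow_div_le {a x P Q : ℝ} (hP : 0 < P) (hQ : 0 < Q) (hx : 0 ≤ x) (hxa : x ≤ a) :
    (a ^ Q - x ^ Q) ^ (P / Q) ≤ a ^ P - min 1 (P / Q) * (a ^ (P - Q) * x ^ Q) := by
  rcases (hx.trans hxa).eq_or_lt with ha | ha
  · have hx0 : x = 0 := by linarith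
    subst hx0
    subst ha
    simp [Real.zero_rpow hP.ne', Real.zero_rpow hQ.ne', Real.zero_rpow (div_pos hP hQ).ne']
  · have haQ : 0 < a ^ Q := Real.rpow_pos_of_pos ha _
    have hu1 : x ^ Q / a ^ Q ≤ 1 := by
      rw [div_le_one haQ]; exact Real.rpow_le_rpow hx hxa hQ.le
    have hu0 : 0 ≤ x ^ Q / a ^ Q := by positivity
    have h1 : a ^ Q - x ^ Q = a ^ Q * (1 - x ^ Q / a ^ Q) := by field_simp
    have h2 : (a ^ Q) ^ (P / Q) = a ^ P := by
      rw [← Real.rpow_mul ha.le]; congr 1; field_simp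
    rw [h1, Real.mul_rpow haQ.le (by linarith), h2, Real.rpow_sub ha]
    calc a ^ P * (1 - x ^ Q / a ^ Q) ^ (P / Q)
        ≤ a ^ P * (1 - min 1 (P / Q) * (x ^ Q / a ^ Q)) := by
          gcongr; exact one_sub_rpow_le hu0 hu1 (div_pos hP hQ).le
      _ = _ := by field_simp

/-- Removing the coordinate `e` gains a multiple of `F e` times that coordinate. -/
theorem norm_rpow_le_of_coord_eq_zero (hp : 1 < p.toReal) (hq : 1 < q.toReal)
    {f g : MixedLp 𝕜 p q}
    (hf : f ≠ 0) {F : MixedLp 𝕜 p q →L[𝕜] 𝕜} (hF : IsNormingFunctional 𝕜 F f) (e : ℕ × ℕ)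
    (hg : ∀ e', e' ≠ e → coord e' g = coord e' f) (hge : coord e g = 0) :
    ‖g‖ ^ p.toReal ≤ (1 - min 1 (p.toReal / q.toReal) *
      (‖F (canonicalBasis 𝕜 p q e)‖ * (‖coord e f‖ / ‖f‖))) * ‖f‖ ^ p.toReal := by
  have hP0 : 0 < p.toReal := by linarith
  have hQ0 : 0 < q.toReal := by linarith
  have hρ : 0 < ‖f‖ := norm_pos_iff.2 hf
  have h1 := norm_rpow_of_coord_eq hP0 hQ0 e hg
  rw [hge, norm_zero, Real.zero_rpow hQ0.ne', add_zero] at h1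
  have h2 := sub_rpow_div_le hP0 hQ0 (norm_nonneg _) (norm_coord_le f e)
  have h3 := norm_apply_canonicalBasis hp hq hf hF e
  have h4 : ‖F (canonicalBasis 𝕜 p q e)‖ * (‖coord e f‖ / ‖f‖) * ‖f‖ ^ p.toReal
      = ‖f e.1‖ ^ (p.toReal - q.toReal) * ‖coord e f‖ ^ q.toReal := by
    have h5 : ‖coord e f‖ ^ q.toReal = ‖coord e f‖ ^ (q.toReal - 1) * ‖coord e f‖ := by
      rcases (norm_nonneg (coord e f)).eq_or_lt with h | h
      · rw [← h, Real.zero_rpow hQ0.ne', mul_zero]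
      · rw [Real.rpow_sub_one h.ne']; field_simp
    rw [h5, ← mul_assoc, ← h3, Real.rpow_sub_one hρ.ne']
    field_simp
  rw [sub_mul, one_mul, mul_assoc (min _ _), h4]
  linarith

/-- The value `t` of a norming functional at a basis vector and the relative size `y` of the
coordinate determine one another up to powers: `y ^ (max p q - 1) ≤ t ≤ y ^ (min p q - 1)`. -/
theorem norm_apply_canonicalBasis_bounds (hp : 1 < p.toReal) (hq : 1 < q.toReal)
    {f : MixedLp 𝕜 p q}
    (hf : f ≠ 0) {F : MixedLp 𝕜 p q →L[𝕜] 𝕜} (hF : IsNormingFunctional 𝕜 F f) (e : ℕ × ℕ) :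
    (‖coord e f‖ / ‖f‖) ^ (max p.toReal q.toReal - 1) ≤ ‖F (canonicalBasis 𝕜 p q e)‖ ∧
    ‖F (canonicalBasis 𝕜 p q e)‖ ≤ (‖coord e f‖ / ‖f‖) ^ (min p.toReal q.toReal - 1) := by
  have h3 := norm_apply_canonicalBasis hp hq hf hF e
  have hρ : 0 < ‖f‖ := norm_pos_iff.2 hf
  have hxa := norm_coord_le f e
  have haρ := norm_row_le f e.1
  generalize ‖F (canonicalBasis 𝕜 p q e)‖ = t at *
  generalize p.toReal = P at *
  generalize q.toReal = Q at *
  rcases (norm_nonneg (coord e f)).eq_or_lt with hx | hx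
  · rw [← hx, Real.zero_rpow (by linarith), mul_zero] at h3
    have ht : t = 0 := by
      rcases mul_eq_zero.1 h3 with h | h
      · exact h
      · exact absurd h (Real.rpow_pos_of_pos hρ _).ne'
    have hmax : max P Q - 1 ≠ 0 := by
      have := lt_max_of_lt_left (c := Q) hp; linarith
    have hmin : min P Q - 1 ≠ 0 := by
      have := lt_min hp hq; linarith
    simp [← hx, ht, Real.zero_rpow hmax, Real.zero_rpow hmin]
  · generalize ‖coord e f‖ = x at *
    generalize ‖f e.1‖ = a at *
    generalize ‖f‖ = ρ at *
    have ha : 0 < a := by linarith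
    have ht : t = (a / ρ) ^ (P - Q) * (x / ρ) ^ (Q - 1) := by
      rw [Real.div_rpow ha.le hρ.le, Real.div_rpow hx.le hρ.le, div_mul_div_comm, ← h3,
        ← Real.rpow_add hρ]
      have : P - Q + (Q - 1) = P - 1 := by ring
      rw [this]
      have := (Real.rpow_pos_of_pos hρ (P - 1)).ne'
      field_simp
    have hy : 0 < x / ρ := by positivity
    have hα : 0 < a / ρ := by positivity
    have hyα : x / ρ ≤ a / ρ := by gcongr
    have hα1 : a / ρ ≤ 1 := (div_le_one hρ).2 haρ
    have hsplit : (x / ρ) ^ (P - 1) = (x / ρ) ^ (P - Q) * (x / ρ) ^ (Q - 1) := by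
      rw [← Real.rpow_add hy]; congr 1; ring
    rw [ht]
    rcases le_total P Q with h | h
    · rw [max_eq_right h, min_eq_left h, hsplit]
      refine ⟨le_mul_of_one_le_left (by positivity) ?_, ?_⟩
      · exact Real.one_le_rpow_of_pos_of_le_one_of_nonpos hα hα1 (by linarith)
      · gcongr ?_ * _
        exact Real.rpow_le_rpow_of_nonpos hy hyα (sub_nonpos.2 h)
    · rw [max_eq_left h, min_eq_right h, hsplit]
      refine ⟨?_, mul_le_of_le_one_left (by positivity) ?_⟩
      · gcongr
      · exact Real.rpow_le_one hα.le hα1 (by linarith)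

end MixedNorm

/-! ### Residuals of the algorithm -/

section Residual

variable {𝕜 : Type*} [RCLike 𝕜] {p q : ℝ≥0∞} [Fact (1 ≤ q)]

theorem coord_sum_smul (c : ℕ × ℕ → 𝕜) (Y : Finset (ℕ × ℕ)) (e : ℕ × ℕ) :
    coord e (∑ e' ∈ Y, c e' • canonicalBasis 𝕜 p q e') = if e ∈ Y then c e else 0 := by
  simp [map_sum, coord_canonicalBasis]

theorem coord_eq_zero_of_mem_span {Y : Set (ℕ × ℕ)} {g : MixedLp 𝕜 p q}
    (hg : g ∈ Submodule.span 𝕜 (canonicalBasis 𝕜 p q '' Y)) {e : ℕ × ℕ} (he : e ∉ Y) :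
    coord e g = 0 := by
  have : Submodule.span 𝕜 (canonicalBasis 𝕜 p q '' Y) ≤ LinearMap.ker (coord e) := by
    rw [Submodule.span_le]
    rintro _ ⟨e', he', rfl⟩
    have : e ≠ e' := fun h => he (h ▸ he')
    simp [coord_canonicalBasis, this]
  exact this hg

theorem sum_smul_mem_span (c : ℕ × ℕ → 𝕜) (Y : Finset (ℕ × ℕ)) :
    ∑ e ∈ Y, c e • canonicalBasis 𝕜 p q e ∈
      Submodule.span 𝕜 (canonicalBasis 𝕜 p q '' (Y : Set (ℕ × ℕ))) :=
  Submodule.sum_mem _ fun e he =>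
    Submodule.smul_mem _ _ (Submodule.subset_span ⟨e, he, rfl⟩)

/-- The vector `f` with its coordinates in the finite set `Y` replaced by `0`. -/
noncomputable def zeroOn (f : MixedLp 𝕜 p q) (Y : Finset (ℕ × ℕ)) : MixedLp 𝕜 p q :=
  f - ∑ e ∈ Y, coord e f • canonicalBasis 𝕜 p q e

theorem coord_zeroOn (f : MixedLp 𝕜 p q) (Y : Finset (ℕ × ℕ)) (e : ℕ × ℕ) :
    coord e (zeroOn f Y) = if e ∈ Y then 0 else coord e f := by
  rw [zeroOn, map_sub, coord_sum_smul fun e => coord e f]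
  split_ifs <;> simp

theorem zeroOn_zeroOn (f : MixedLp 𝕜 p q) (Y Z : Finset (ℕ × ℕ)) :
    zeroOn (zeroOn f Y) Z = zeroOn f (Y ∪ Z) := by
  apply MixedLp.ext_coord
  intro e
  simp only [coord_zeroOn, Finset.mem_union]
  split_ifs <;> tauto

variable [Fact (1 ≤ p)]

theorem norm_zeroOn_anti (f : MixedLp 𝕜 p q) {Y Z : Finset (ℕ × ℕ)} (h : Y ⊆ Z) :
    ‖zeroOn f Z‖ ≤ ‖zeroOn f Y‖ := by
  apply norm_le_of_norm_coord_le
  intro e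
  simp only [coord_zeroOn]
  by_cases h1 : e ∈ Y
  · simp [h1, h h1]
  · split_ifs <;> simp

theorem norm_zeroOn_le_add (f : MixedLp 𝕜 p q) {Y Y₁ Y₂ : Finset (ℕ × ℕ)} (h : Y₁ ∩ Y₂ ⊆ Y) :
    ‖zeroOn f Y‖ ≤ ‖zeroOn f Y₁‖ + ‖zeroOn f Y₂‖ := by
  have h1 : ‖zeroOn f (Y ∪ Y₁)‖ ≤ ‖zeroOn f Y₁‖ := norm_zeroOn_anti f Finset.subset_union_right
  have h2 : ‖zeroOn f Y - zeroOn f (Y ∪ Y₁)‖ ≤ ‖zeroOn f Y₂‖ := by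
    apply norm_le_of_norm_coord_le
    intro e
    have := @h e
    simp only [Finset.mem_inter] at this
    simp only [map_sub, coord_zeroOn, Finset.mem_union]
    split_ifs <;> simp <;> tauto
  calc ‖zeroOn f Y‖ = ‖zeroOn f (Y ∪ Y₁) + (zeroOn f Y - zeroOn f (Y ∪ Y₁))‖ := by
        congr 1; abel
    _ ≤ _ := (norm_add_le _ _).trans (add_le_add h1 h2)

theorem norm_zeroOn_le_norm_sub {Y : Finset (ℕ × ℕ)} (f : MixedLp 𝕜 p q) {g : MixedLp 𝕜 p q}
    (hg : g ∈ Submodule.span 𝕜 (canonicalBasis 𝕜 p q '' Y)) : ‖zeroOn f Y‖ ≤ ‖f - g‖ := by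
  apply norm_le_of_norm_coord_le
  intro e
  rw [coord_zeroOn, map_sub]
  split_ifs with h
  · simp
  · simp [coord_eq_zero_of_mem_span hg (e := e) (by simpa using h)]

theorem norm_zeroOn_singleton_lt (hp : 0 < p.toReal) (hq : 0 < q.toReal) (f : MixedLp 𝕜 p q)
    {e : ℕ × ℕ} (he : coord e f ≠ 0) : ‖zeroOn f {e}‖ < ‖f‖ := by
  have h1 := norm_rpow_of_coord_eq hp hq (f := f) (g := zeroOn f {e}) e fun e' he' => by
    simp [coord_zeroOn, he']
  have h2 : coord e (zeroOn f {e}) = 0 := by simp [coord_zeroOn]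
  rw [h2, norm_zero, Real.zero_rpow hq.ne', add_zero] at h1
  have hx : 0 < ‖coord e f‖ ^ q.toReal := Real.rpow_pos_of_pos (norm_pos_iff.2 he) _
  have hxa := Real.rpow_le_rpow (norm_nonneg _) (norm_coord_le f e) hq.le
  have h3 : (‖f e.1‖ ^ q.toReal - ‖coord e f‖ ^ q.toReal) ^ (p.toReal / q.toReal)
      < (‖f e.1‖ ^ q.toReal) ^ (p.toReal / q.toReal) :=
    Real.rpow_lt_rpow (by linarith) (by linarith) (div_pos hp hq)
  rw [← Real.rpow_mul (norm_nonneg _), mul_div_cancel₀ _ hq.ne'] at h3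
  exact (Real.rpow_lt_rpow_iff (norm_nonneg _) (norm_nonneg _) hp).1 (by linarith)

theorem chosenSpan_eq_span_image (i : ℕ → ℕ × ℕ) (n : ℕ) :
    chosenSpan 𝕜 (canonicalBasis 𝕜 p q) i n = Submodule.span 𝕜
      (canonicalBasis 𝕜 p q '' ((Finset.range (n + 1)).image i : Finset (ℕ × ℕ))) := by
  rw [chosenSpan]
  congr 1
  ext x
  simp only [Set.mem_image, Set.mem_Iic, Finset.coe_image, Finset.coe_range, Set.mem_Iio,
    exists_exists_and_eq_and, Nat.lt_succ_iff]

/-- The best approximation from the span of the selected basis vectors is the coordinate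
projection, which makes the residuals of the algorithm explicit. -/
theorem IsWCGARun.sub_eq_zeroOn (hp : 0 < p.toReal) (hq : 0 < q.toReal) {τ : ℝ}
    {f : MixedLp 𝕜 p q} {i : ℕ → ℕ × ℕ} {G : ℕ → MixedLp 𝕜 p q}
    (h : IsWCGARun 𝕜 (canonicalBasis 𝕜 p q) τ f i G) (n : ℕ) :
    f - G n = zeroOn f ((Finset.range n).image i) := by
  induction n with
  | zero => simp [h.init, zeroOn]
  | succ n ih =>
    set Y := (Finset.range (n + 1)).image i with hY
    by_cases h0 : f - G n = 0
    · rw [h.terminal n h0, h0]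
      have h1 := norm_zeroOn_anti f (show (Finset.range n).image i ⊆ Y from
        Finset.image_subset_image (by intro; simp; omega))
      rw [← ih, h0, norm_zero] at h1
      exact (norm_le_zero_iff.1 h1).symm
    · have hspan := h.mem_span n h0
      have hcheb := h.chebyshev n h0
      rw [chosenSpan_eq_span_image, ← hY] at hspan hcheb
      apply MixedLp.ext_coord
      intro e
      rw [coord_zeroOn]
      split_ifs with he
      · by_contra hne
        have h1 := norm_zeroOn_singleton_lt hp hq _ hne
        have h2 : zeroOn (f - G (n + 1)) {e}
            = f - (G (n + 1) + coord e (f - G (n + 1)) • canonicalBasis 𝕜 p q e) := by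
          simp only [zeroOn, Finset.sum_singleton]; abel
        have h3 : G (n + 1) + coord e (f - G (n + 1)) • canonicalBasis 𝕜 p q e ∈
            Submodule.span 𝕜 (canonicalBasis 𝕜 p q '' (Y : Set (ℕ × ℕ))) :=
          Submodule.add_mem _ hspan
            (Submodule.smul_mem _ _ (Submodule.subset_span ⟨e, he, rfl⟩))
        have h4 := Metric.infDist_le_dist_of_mem (x := f) h3
        rw [dist_eq_norm, ← h2, ← hcheb] at h4
        linarith
      · rw [map_sub, coord_eq_zero_of_mem_span hspan (e := e) (by simpa using he), sub_zero]

/-! ### The upper bound on the number of steps -/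

theorem wcgaExponent_eq {p q : ℝ≥0∞} (hp : 1 < p.toReal) (hq : 1 < q.toReal) :
    wcgaExponent p q = Real.conjExponent (min p.toReal q.toReal) /
      Real.conjExponent (max p.toReal q.toReal) := by
  have hanti : ∀ a b : ℝ, 1 < a → a ≤ b → Real.conjExponent b / Real.conjExponent a
      ≤ Real.conjExponent a / Real.conjExponent b := by
    intro a b ha hab
    have hle : Real.conjExponent b ≤ Real.conjExponent a := by
      rw [Real.conjExponent, Real.conjExponent, div_le_div_iff₀ (by linarith) (by linarith)]
      nlinarith
    have hb : 0 < Real.conjExponent b := div_pos (by linarith) (by linarith)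
    have ha' : 0 < Real.conjExponent a := hb.trans_le hle
    exact ((div_le_one ha').2 hle).trans ((one_le_div hb).2 hle)
  rw [wcgaExponent]
  rcases le_total p.toReal q.toReal with h | h
  · rw [min_eq_left h, max_eq_right h, max_eq_left (hanti _ _ hp h)]
  · rw [min_eq_right h, max_eq_left h, max_eq_right (hanti _ _ hq h)]

theorem one_le_wcgaExponent {p q : ℝ≥0∞} (hp : 1 < p.toReal) (hq : 1 < q.toReal) :
    1 ≤ wcgaExponent p q := by
  have h1 : 0 < Real.conjExponent p.toReal := div_pos (by linarith) (by linarith)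
  have h2 : 0 < Real.conjExponent q.toReal := div_pos (by linarith) (by linarith)
  rw [wcgaExponent]
  rcases le_total (Real.conjExponent p.toReal) (Real.conjExponent q.toReal) with h | h
  · exact le_max_of_le_right ((one_le_div h1).2 h)
  · exact le_max_of_le_left ((one_le_div h2).2 h)

/-- If the coordinates in a set `T` of at most `M` indices carry half of the residual, the greedy
step shrinks the `p`-th power of the residual by a factor `1 - c M^{-β}`: some `t = ‖F e‖`, `e ∈ T`,
is at least of order `M^{-1/s}` with `s` the conjugate of `max p q`, and the gain at the selected
index is at least of order `t^r` with `r` the conjugate of `min p q`; here `r / s = β`. -/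
theorem norm_rpow_zeroOn_greedy_le (hp : 1 < p.toReal) (hq : 1 < q.toReal) {τ : ℝ} (hτ : 0 < τ)
    {f : MixedLp 𝕜 p q} (hf : f ≠ 0) {F : MixedLp 𝕜 p q →L[𝕜] 𝕜}
    (hF : IsNormingFunctional 𝕜 F f) {e₀ : ℕ × ℕ}
    (he₀ : ∀ e, τ * ‖F (canonicalBasis 𝕜 p q e)‖ ≤ ‖F (canonicalBasis 𝕜 p q e₀)‖)
    {M : ℕ} (hM : 1 ≤ M) {T : Finset (ℕ × ℕ)} (hT : T.card ≤ M) (hhalf : ‖zeroOn f T‖ ≤ ‖f‖ / 2) :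
    ‖zeroOn f {e₀}‖ ^ p.toReal ≤ (1 - min 1 (p.toReal / q.toReal) *
      (τ ^ Real.conjExponent (min p.toReal q.toReal) * (1 / 2) ^ wcgaExponent p q) *
        (M : ℝ) ^ (-wcgaExponent p q)) * ‖f‖ ^ p.toReal := by
  have hρ : 0 < ‖f‖ := norm_pos_iff.2 hf
  have hM0 : (0 : ℝ) < M := by exact_mod_cast hM
  have hmin1 : 1 < min p.toReal q.toReal := lt_min hp hq
  have hmax1 : 1 < max p.toReal q.toReal := lt_max_of_lt_left hp
  have hβ := wcgaExponent_eq hp hq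
  refine (norm_rpow_le_of_coord_eq_zero hp hq hf hF e₀ (fun e' he' => by
    simp [coord_zeroOn, he']) (by simp [coord_zeroOn])).trans ?_
  set m := min p.toReal q.toReal with hm
  set m' := max p.toReal q.toReal with hm'
  set r := Real.conjExponent m with hr
  set s := Real.conjExponent m' with hs
  have hr0 : 0 < r := div_pos (by linarith) (by linarith)
  have hs0 : 0 < s := div_pos (by linarith) (by linarith)
  set D := canonicalBasis 𝕜 p q with hD
  set t₀ := ‖F (D e₀)‖ with ht₀
  have hW0 : 0 ≤ t₀ / τ := by positivity
  have hsum : 1 / 2 ≤ ∑ e ∈ T, ‖F (D e)‖ * (‖coord e f‖ / ‖f‖) := by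
    have h1 : F (f - zeroOn f T) = ∑ e ∈ T, coord e f * F (D e) := by
      simp [zeroOn, hD, map_sum]
    have h2 : ‖F (f - zeroOn f T)‖ ≤ ∑ e ∈ T, ‖F (D e)‖ * ‖coord e f‖ := by
      rw [h1]
      refine (norm_sum_le _ _).trans (le_of_eq (Finset.sum_congr rfl fun e _ => ?_))
      rw [norm_mul, mul_comm]
    have h3 : ‖f‖ - ‖zeroOn f T‖ ≤ ‖F (f - zeroOn f T)‖ := by
      rw [map_sub, hF.2]
      refine le_trans ?_ (norm_sub_norm_le _ _)
      have h4 := F.le_opNorm (zeroOn f T)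
      rw [hF.1, one_mul] at h4
      rw [RCLike.norm_ofReal, abs_norm]
      linarith
    have h5 : ∑ e ∈ T, ‖F (D e)‖ * (‖coord e f‖ / ‖f‖)
        = (∑ e ∈ T, ‖F (D e)‖ * ‖coord e f‖) / ‖f‖ := by
      rw [Finset.sum_div]
      exact Finset.sum_congr rfl fun e _ => by ring
    rw [h5, le_div_iff₀ hρ]
    linarith
  have hterm : ∀ e ∈ T, ‖F (D e)‖ * (‖coord e f‖ / ‖f‖) ≤ (t₀ / τ) ^ s := by
    intro e _
    obtain ⟨hlow, -⟩ := norm_apply_canonicalBasis_bounds hp hq hf hF e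
    have hte : ‖F (D e)‖ ≤ t₀ / τ := by
      rw [le_div_iff₀ hτ, mul_comm]; exact he₀ e
    have hy : ‖coord e f‖ / ‖f‖ ≤ (t₀ / τ) ^ (1 / (m' - 1)) := by
      have h6 : ((‖coord e f‖ / ‖f‖) ^ (m' - 1)) ^ (1 / (m' - 1))
          ≤ (t₀ / τ) ^ (1 / (m' - 1)) :=
        Real.rpow_le_rpow (by positivity) (hlow.trans hte) (by
          have : 0 < m' - 1 := by linarith
          positivity)
      rwa [← Real.rpow_mul (by positivity), mul_one_div_cancel (by linarith), Real.rpow_one] at h6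
    have hsplit : (t₀ / τ) ^ s = (t₀ / τ) * (t₀ / τ) ^ (1 / (m' - 1)) := by
      have h7 : s = 1 + 1 / (m' - 1) := by
        have : m' - 1 ≠ 0 := by linarith
        rw [hs, Real.conjExponent]; field_simp; ring
      rw [h7, Real.rpow_add' hW0 (by rw [← h7]; exact hs0.ne'), Real.rpow_one]
    rw [hsplit]
    gcongr
  have hWs : 1 / 2 / M ≤ (t₀ / τ) ^ s := by
    rw [div_le_iff₀ hM0]
    refine hsum.trans ((Finset.sum_le_card_nsmul _ _ _ hterm).trans ?_)
    rw [nsmul_eq_mul, mul_comm]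
    gcongr
  have hgain : τ ^ r * (1 / 2) ^ wcgaExponent p q * (M : ℝ) ^ (-wcgaExponent p q)
      ≤ t₀ * (‖coord e₀ f‖ / ‖f‖) := by
    obtain ⟨-, hup⟩ := norm_apply_canonicalBasis_bounds hp hq hf hF e₀
    have hy : t₀ ^ (1 / (m - 1)) ≤ ‖coord e₀ f‖ / ‖f‖ := by
      have h6 : t₀ ^ (1 / (m - 1)) ≤ ((‖coord e₀ f‖ / ‖f‖) ^ (m - 1)) ^ (1 / (m - 1)) :=
        Real.rpow_le_rpow (by positivity) hup (by
          have : 0 < m - 1 := by linarith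
          positivity)
      rwa [← Real.rpow_mul (by positivity), mul_one_div_cancel (by linarith), Real.rpow_one] at h6
    have hsplit : t₀ ^ r = t₀ * t₀ ^ (1 / (m - 1)) := by
      have h7 : r = 1 + 1 / (m - 1) := by
        have : m - 1 ≠ 0 := by linarith
        rw [hr, Real.conjExponent]; field_simp; ring
      rw [h7, Real.rpow_add' (norm_nonneg _) (by rw [← h7]; exact hr0.ne'), Real.rpow_one]
    have h8 : (1 / 2 / (M : ℝ)) ^ wcgaExponent p q ≤ ((t₀ / τ) ^ s) ^ wcgaExponent p q :=
      Real.rpow_le_rpow (by positivity) hWs (by rw [hβ]; positivity)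
    have h9 : ((t₀ / τ) ^ s) ^ wcgaExponent p q = t₀ ^ r / τ ^ r := by
      rw [← Real.rpow_mul hW0, hβ, mul_div_cancel₀ _ hs0.ne', Real.div_rpow (norm_nonneg _) hτ.le]
    rw [h9, Real.div_rpow (by norm_num) hM0.le, le_div_iff₀ (by positivity)] at h8
    rw [Real.rpow_neg hM0.le]
    calc τ ^ r * (1 / 2) ^ wcgaExponent p q * ((M : ℝ) ^ wcgaExponent p q)⁻¹
        = (1 / 2) ^ wcgaExponent p q / (M : ℝ) ^ wcgaExponent p q * τ ^ r := by
          field_simp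
      _ ≤ t₀ ^ r := h8
      _ = t₀ * t₀ ^ (1 / (m - 1)) := hsplit
      _ ≤ _ := by gcongr
  have hκ : 0 ≤ min 1 (p.toReal / q.toReal) :=
    le_min zero_le_one (div_nonneg ENNReal.toReal_nonneg ENNReal.toReal_nonneg)
  have hρP : 0 ≤ ‖f‖ ^ p.toReal := by positivity
  gcongr ?_ * _
  rw [mul_assoc]
  gcongr

theorem exists_wcgaLebesgueInequality (hp : 1 < p.toReal) (hq : 1 < q.toReal) {τ : ℝ}
    (hτ : 0 < τ) : ∃ c : ℝ, 0 < c ∧ WCGALebesgueInequality 𝕜 (canonicalBasis 𝕜 p q) τ 4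
      (fun N => ⌊c * (N : ℝ) ^ wcgaExponent p q⌋₊) := by
  set β := wcgaExponent p q with hβ
  have hβ1 : 1 ≤ β := one_le_wcgaExponent hp hq
  have hp0 : 0 < p.toReal := by linarith
  have hq0 : 0 < q.toReal := by linarith
  set c₀ := min 1 (p.toReal / q.toReal) *
      (τ ^ Real.conjExponent (min p.toReal q.toReal) * (1 / 2) ^ β) with hc₀
  have hc₀pos : 0 < c₀ := by
    have : 0 < min 1 (p.toReal / q.toReal) := lt_min one_pos (div_pos hp0 hq0)
    positivity
  set K := p.toReal * Real.log 16 / c₀ + 1 with hK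
  have hKpos : 0 < K := by
    have := Real.log_pos (show (1 : ℝ) < 16 by norm_num)
    positivity
  refine ⟨2 * K * 2 ^ β, by positivity, ?_⟩
  intro N _ f i G hrun
  set A : ℕ → Finset (ℕ × ℕ) := fun n => (Finset.range n).image i with hA
  have hAmono : Monotone A := fun a b hab =>
    Finset.image_subset_image (Finset.range_subset_range.2 hab)
  have hres : ∀ n, f - G n = zeroOn f (A n) := hrun.sub_eq_zeroOn hp0 hq0
  have hAsucc : ∀ n, zeroOn f (A (n + 1)) = zeroOn (zeroOn f (A n)) {i n} := by
    intro n
    rw [zeroOn_zeroOn]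
    congr 1
    simp only [hA, Finset.range_add_one, Finset.image_insert]
    rw [Finset.union_comm, Finset.insert_eq]
  have hstep : ∀ (k M : ℕ) (T : Finset (ℕ × ℕ)), 1 ≤ M → T.card ≤ M →
      ‖zeroOn f (A k ∪ T)‖ ≤ ‖zeroOn f (A k)‖ / 2 →
      ‖zeroOn f (A (k + 1))‖ ^ p.toReal
        ≤ (1 - c₀ * (M : ℝ) ^ (-β)) * ‖zeroOn f (A k)‖ ^ p.toReal := by
    intro k M T hM hT hhalf
    by_cases h0 : f - G k = 0
    · have h1 := norm_zeroOn_anti f (hAmono (Nat.le_succ k))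
      rw [← hres k, h0, norm_zero] at h1 ⊢
      rw [le_antisymm h1 (norm_nonneg _), Real.zero_rpow hp0.ne', mul_zero]
    · obtain ⟨F, hF, hgr⟩ := hrun.greedy k h0
      rw [hres k] at h0 hF
      rw [← zeroOn_zeroOn] at hhalf
      rw [hAsucc]
      exact norm_rpow_zeroOn_greedy_le hp hq hτ h0 hF hgr hM hT hhalf
  have hdec := exists_steps_le_max (N := fun Y => ‖zeroOn f Y‖) (by linarith) hc₀pos hp0
    (fun _ => norm_nonneg _) (fun _ _ h => norm_zeroOn_anti f h) hAmono hstep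
  have hmain : ∀ g ∈ sparseVectors 𝕜 (canonicalBasis 𝕜 p q) N,
      ‖f - G ⌊2 * K * 2 ^ β * (N : ℝ) ^ β⌋₊‖ ≤ 4 * dist f g := by
    rintro g ⟨B, hB, hg⟩
    obtain ⟨L, hL, hNL⟩ := exists_steps_residual_le (N := fun Y => ‖zeroOn f Y‖) hβ1 hKpos.le
      (fun _ => norm_nonneg _) (fun _ _ h => norm_zeroOn_anti f h)
      (fun _ _ _ h => norm_zeroOn_le_add f h) hAmono hdec B _ 0 rfl
    have hLn : L ≤ ⌊2 * K * 2 ^ β * (N : ℝ) ^ β⌋₊ := by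
      apply Nat.le_floor
      refine hL.trans ?_
      gcongr
      exact (Finset.card_le_card Finset.sdiff_subset).trans hB
    rw [hres, dist_eq_norm]
    simp only [zero_add] at hNL
    calc ‖zeroOn f (A ⌊2 * K * 2 ^ β * (N : ℝ) ^ β⌋₊)‖ ≤ ‖zeroOn f (A L)‖ :=
          norm_zeroOn_anti f (hAmono hLn)
      _ ≤ 4 * ‖zeroOn f B‖ := hNL
      _ ≤ 4 * ‖f - g‖ := by gcongr; exact norm_zeroOn_le_norm_sub f hg
  have hne : (sparseVectors 𝕜 (canonicalBasis 𝕜 p q) N).Nonempty :=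
    ⟨0, ∅, by simp, Submodule.zero_mem _⟩
  have h4 : ‖f - G ⌊2 * K * 2 ^ β * (N : ℝ) ^ β⌋₊‖ / 4
      ≤ Metric.infDist f (sparseVectors 𝕜 (canonicalBasis 𝕜 p q) N) := by
    rw [Metric.le_infDist hne]
    intro g hg
    have := hmain g hg
    linarith
  rw [bestApproxError]
  linarith

end Residual

/-! ### Runs that postpone a chosen set of coordinates -/

section LowerBound

variable {𝕜 : Type*} [RCLike 𝕜] {p q : ℝ≥0∞} [Fact (1 ≤ q)] [Fact (1 ≤ p)]

theorem exists_normingFunctional_forall_norm_le (hp : 1 < p.toReal) (hq : 1 < q.toReal)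
    {f : MixedLp 𝕜 p q} (hf : f ≠ 0) {S : Finset (ℕ × ℕ)} (hS : ∀ e ∉ S, coord e f = 0) :
    ∃ e, ∃ F : MixedLp 𝕜 p q →L[𝕜] 𝕜, IsNormingFunctional 𝕜 F f ∧
      ∀ e', ‖F (canonicalBasis 𝕜 p q e')‖ ≤ ‖F (canonicalBasis 𝕜 p q e)‖ := by
  have hρ : 0 < ‖f‖ := norm_pos_iff.2 hf
  obtain ⟨F, hF1, hF2⟩ := exists_dual_vector 𝕜 f hρ.ne'
  have hF : IsNormingFunctional 𝕜 F f := ⟨hF1, hF2⟩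
  have hSne : S.Nonempty := by
    by_contra h
    rw [Finset.not_nonempty_iff_eq_empty] at h
    exact hf (MixedLp.ext_coord fun e => by simp [hS e (by simp [h])])
  obtain ⟨e, -, he⟩ := S.exists_max_image (fun e => ‖F (canonicalBasis 𝕜 p q e)‖) hSne
  refine ⟨e, F, hF, fun e' => ?_⟩
  by_cases h : e' ∈ S
  · exact he e' h
  · have h1 := norm_apply_canonicalBasis hp hq hf hF e'
    rw [hS e' h, norm_zero, Real.zero_rpow (by linarith), mul_zero] at h1
    rcases mul_eq_zero.1 h1 with h2 | h2
    · rw [h2]; exact norm_nonneg _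
    · exact absurd h2 (Real.rpow_pos_of_pos hρ _).ne'

theorem exists_isWCGARun (hp : 1 < p.toReal) (hq : 1 < q.toReal) {f : MixedLp 𝕜 p q}
    {S : Finset (ℕ × ℕ)} (hS : ∀ e ∉ S, coord e f = 0) :
    ∃ (i : ℕ → ℕ × ℕ) (G : ℕ → MixedLp 𝕜 p q),
      IsWCGARun 𝕜 (canonicalBasis 𝕜 p q) 1 f i G := by
  have hex : ∀ Y : Finset (ℕ × ℕ), ∃ e, zeroOn f Y ≠ 0 →
      ∃ F : MixedLp 𝕜 p q →L[𝕜] 𝕜, IsNormingFunctional 𝕜 F (zeroOn f Y) ∧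
        ∀ e', ‖F (canonicalBasis 𝕜 p q e')‖ ≤ ‖F (canonicalBasis 𝕜 p q e)‖ := by
    intro Y
    by_cases h : zeroOn f Y = 0
    · exact ⟨0, fun h' => absurd h h'⟩
    · obtain ⟨e, he⟩ := exists_normingFunctional_forall_norm_le hp hq h (S := S) fun e he => by
        rw [coord_zeroOn, hS e he, ite_self]
      exact ⟨e, fun _ => he⟩
  choose next hnext using hex
  let A : ℕ → Finset (ℕ × ℕ) := fun n => Nat.rec ∅ (fun _ Y => insert (next Y) Y) n
  have hA1 : ∀ n, A (n + 1) = insert (next (A n)) (A n) := fun _ => rfl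
  have hAi : ∀ n, A n = (Finset.range n).image fun k => next (A k) := by
    intro n
    induction n with
    | zero => rfl
    | succ n ih => rw [hA1, Finset.range_add_one, Finset.image_insert, ← ih]
  refine ⟨fun n => next (A n), fun n => f - zeroOn f (A n), ?_, ?_, ?_, ?_, ?_⟩
  · show f - zeroOn f ∅ = 0
    simp [zeroOn]
  · intro n hn
    rw [sub_sub_cancel] at hn ⊢
    simpa using hnext (A n) hn
  · intro n _
    rw [chosenSpan_eq_span_image, ← hAi, zeroOn, sub_sub_cancel]
    exact sum_smul_mem_span (fun e => coord e f) _
  · intro n _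
    rw [chosenSpan_eq_span_image, ← hAi, sub_sub_cancel]
    apply le_antisymm
    · rw [Metric.le_infDist ⟨0, Submodule.zero_mem _⟩]
      intro g hg
      rw [dist_eq_norm]
      exact norm_zeroOn_le_norm_sub f hg
    · have h1 := Metric.infDist_le_dist_of_mem (x := f)
        (sum_smul_mem_span (p := p) (q := q) (fun e => coord e f) (A (n + 1)))
      rwa [dist_eq_norm] at h1
  · intro n hn
    rw [sub_sub_cancel] at hn
    have h1 := norm_zeroOn_anti f (show A n ⊆ A (n + 1) from Finset.subset_insert _ _)
    rw [hn, norm_zero] at h1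
    show f - zeroOn f (A (n + 1)) = f - zeroOn f (A n)
    rw [hn, norm_le_zero_iff.1 h1]

theorem IsWCGARun.mono {X ι : Type*} [NormedAddCommGroup X] [NormedSpace 𝕜 X] {D : ι → X}
    {f : X} {i : ℕ → ι} {G : ℕ → X} {τ τ' : ℝ} (hτ : τ' ≤ τ) (h : IsWCGARun 𝕜 D τ f i G) :
    IsWCGARun 𝕜 D τ' f i G where
  init := h.init
  greedy n hn := by
    obtain ⟨F, hF, hgr⟩ := h.greedy n hn
    exact ⟨F, hF, fun j => (mul_le_mul_of_nonneg_right hτ (norm_nonneg _)).trans (hgr j)⟩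
  mem_span := h.mem_span
  chebyshev := h.chebyshev
  terminal := h.terminal

/-- The quantity `‖x j‖^{p-q} |x j k|^{q-1}` which the algorithm maximizes over `(j, k)` when `x`
is the current residual. -/
noncomputable def greedyWeight (f : MixedLp 𝕜 p q) (e : ℕ × ℕ) : ℝ :=
  ‖f e.1‖ ^ (p.toReal - q.toReal) * ‖coord e f‖ ^ (q.toReal - 1)

/-- If during the first `n` steps the set `J` always contains an index of larger weight than all
indices outside `J`, and `J` carries little of the norm, then a Lebesgue-type inequality cannot hold
after `n` steps. -/
theorem lt_of_wcgaLebesgueInequality (hp : 1 < p.toReal) (hq : 1 < q.toReal) {τ C : ℝ}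
    (hτ : τ ≤ 1) (hC : 0 < C) {ψ : ℕ → ℕ}
    (hL : WCGALebesgueInequality 𝕜 (canonicalBasis 𝕜 p q) τ C ψ) {N : ℕ} (hN : 1 ≤ N)
    {f : MixedLp 𝕜 p q} {S B J : Finset (ℕ × ℕ)} (hS : ∀ e ∉ S, coord e f = 0)
    (hB : B.card ≤ N) (hlt : C * ‖zeroOn f B‖ < ‖zeroOn f J‖) {n : ℕ}
    (hJ : ∀ Y ⊆ J, Y.card < n →
      ∃ e, ∀ b ∉ J, greedyWeight (zeroOn f Y) b < greedyWeight (zeroOn f Y) e) :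
    n < ψ N := by
  by_contra! hle
  obtain ⟨i, G, hrun⟩ := exists_isWCGARun hp hq hS
  set A : ℕ → Finset (ℕ × ℕ) := fun n => (Finset.range n).image i with hA
  have hres : ∀ n, f - G n = zeroOn f (A n) :=
    hrun.sub_eq_zeroOn (by linarith) (by linarith)
  have hAJ : ∀ k ≤ n, A k ⊆ J := by
    intro k
    induction k with
    | zero => intro _; simp [hA]
    | succ k ih =>
      intro hk
      have hsub := ih (by omega)
      have hcard : (A k).card < n := by
        have : (A k).card ≤ k := Finset.card_image_le.trans (by simp)
        omega
      obtain ⟨e, he⟩ := hJ (A k) hsub hcard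
      have hne : f - G k ≠ 0 := by
        rw [hres, ← norm_pos_iff]
        exact (lt_of_le_of_lt (by positivity) hlt).trans_le (norm_zeroOn_anti f hsub)
      obtain ⟨F, hF, hgr⟩ := hrun.greedy k hne
      rw [hres] at hF hne
      have hik : i k ∈ J := by
        by_contra hik
        have h1 := he (i k) hik
        rw [greedyWeight, greedyWeight, ← norm_apply_canonicalBasis hp hq hne hF,
          ← norm_apply_canonicalBasis hp hq hne hF] at h1
        have h2 := hgr e
        rw [one_mul] at h2
        exact absurd (mul_le_mul_of_nonneg_right h2 (by positivity)) (not_le.2 h1)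
      simp only [hA, Finset.range_add_one, Finset.image_insert]
      exact Finset.insert_subset hik hsub
  have h1 := hL N hN f i G (hrun.mono hτ)
  rw [hres] at h1
  have h2 : bestApproxError 𝕜 (canonicalBasis 𝕜 p q) N f ≤ ‖zeroOn f B‖ := by
    have := Metric.infDist_le_dist_of_mem (x := f)
      (s := sparseVectors 𝕜 (canonicalBasis 𝕜 p q) N)
      (y := ∑ e ∈ B, coord e f • canonicalBasis 𝕜 p q e)
      ⟨B, hB, sum_smul_mem_span (fun e => coord e f) B⟩
    rwa [dist_eq_norm] at this
  have h3 := norm_zeroOn_anti f (hAJ _ hle)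
  have h4 := mul_le_mul_of_nonneg_left h2 hC.le
  linarith

end LowerBound

/-! ### A row and a column of equal entries -/

/-- The first `m` indices of row `0`. -/
def rowIndices (m : ℕ) : Finset (ℕ × ℕ) := (Finset.range m).image fun k => (0, k)

/-- The first indices of the rows `1, …, m`. -/
def columnIndices (m : ℕ) : Finset (ℕ × ℕ) := (Finset.range m).image fun j => (j + 1, 0)

theorem card_rowIndices (m : ℕ) : (rowIndices m).card = m := by
  rw [rowIndices, Finset.card_image_of_injective _ (by intro a b; simp), Finset.card_range]

theorem card_columnIndices (m : ℕ) : (columnIndices m).card = m := by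
  rw [columnIndices, Finset.card_image_of_injective _ (by intro a b; simp), Finset.card_range]

theorem zero_mem_rowIndices {m k : ℕ} : (0, k) ∈ rowIndices m ↔ k < m := by
  simp [rowIndices]

theorem succ_notMem_rowIndices {m j k : ℕ} : (j + 1, k) ∉ rowIndices m := by
  simp [rowIndices]

theorem zero_notMem_columnIndices {m k : ℕ} : (0, k) ∉ columnIndices m := by
  simp [columnIndices]

theorem succ_mem_columnIndices {m j k : ℕ} : (j + 1, k) ∈ columnIndices m ↔ j < m ∧ k = 0 := by
  simp [columnIndices, eq_comm]

section Cross

variable {𝕜 : Type*} [RCLike 𝕜] {p q : ℝ≥0∞} [Fact (1 ≤ q)]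

variable (𝕜 p q) in
/-- The vector with `m` entries `u` in row `0` and a single entry `v` in each of the next `m'`
rows. -/
noncomputable def crossVector (m m' : ℕ) (u v : ℝ) : MixedLp 𝕜 p q :=
  ∑ e ∈ rowIndices m ∪ columnIndices m',
    (((if e.1 = 0 then u else v : ℝ) : 𝕜)) • canonicalBasis 𝕜 p q e

variable {m m' : ℕ} {u v : ℝ} {Y : Finset (ℕ × ℕ)}

theorem coord_crossVector_zero (k : ℕ) :
    coord (0, k) (crossVector 𝕜 p q m m' u v) = if k < m then (u : 𝕜) else 0 := by
  rw [crossVector, coord_sum_smul fun e => (((if e.1 = 0 then u else v : ℝ) : 𝕜))]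
  simp [zero_mem_rowIndices, zero_notMem_columnIndices]

theorem coord_crossVector_succ (j k : ℕ) :
    coord (j + 1, k) (crossVector 𝕜 p q m m' u v) = if j < m' ∧ k = 0 then (v : 𝕜) else 0 := by
  rw [crossVector, coord_sum_smul fun e => (((if e.1 = 0 then u else v : ℝ) : 𝕜))]
  simp [succ_notMem_rowIndices, succ_mem_columnIndices]

theorem coord_crossVector_eq_zero {e : ℕ × ℕ} (he : e ∉ rowIndices m ∪ columnIndices m') :
    coord e (crossVector 𝕜 p q m m' u v) = 0 := by
  rw [crossVector, coord_sum_smul fun e => (((if e.1 = 0 then u else v : ℝ) : 𝕜)), if_neg he]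

theorem norm_row_zero_zeroOn_crossVector (hq : 0 < q.toReal) (hu : 0 ≤ u) :
    ‖zeroOn (crossVector 𝕜 p q m m' u v) Y 0‖ ^ q.toReal
      = ((Finset.range m).filter fun k => (0, k) ∉ Y).card * u ^ q.toReal := by
  rw [norm_row_rpow_eq_sum hq _ 0 (S := Finset.range m) fun k hk => by
    rw [coord_zeroOn, coord_crossVector_zero, if_neg (show ¬ k < m by simpa using hk), ite_self]]
  rw [Finset.card_filter, Nat.cast_sum, Finset.sum_mul]
  refine Finset.sum_congr rfl fun k hk => ?_
  rw [coord_zeroOn, coord_crossVector_zero, if_pos (show k < m by simpa using hk)]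
  by_cases h : (0, k) ∈ Y
  · simp [h, Real.zero_rpow hq.ne']
  · simp [h, abs_of_nonneg hu]

theorem norm_row_succ_zeroOn_crossVector (hq : 0 < q.toReal) (hv : 0 ≤ v) (j : ℕ) :
    ‖zeroOn (crossVector 𝕜 p q m m' u v) Y (j + 1)‖
      = if j < m' ∧ (j + 1, 0) ∉ Y then v else 0 := by
  have h1 : ‖zeroOn (crossVector 𝕜 p q m m' u v) Y (j + 1)‖
      = ‖coord (j + 1, 0) (zeroOn (crossVector 𝕜 p q m m' u v) Y)‖ := by
    have h2 := norm_row_rpow_eq_sum hq (zeroOn (crossVector 𝕜 p q m m' u v) Y) (j + 1)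
      (S := {0}) fun k hk => by
        rw [coord_zeroOn, coord_crossVector_succ,
          if_neg (show ¬(j < m' ∧ k = 0) from fun h => hk (by simp [h.2])), ite_self]
    rw [Finset.sum_singleton] at h2
    exact (Real.rpow_left_inj (norm_nonneg _) (norm_nonneg _) hq.ne').1 h2
  rw [h1, coord_zeroOn, coord_crossVector_succ]
  split_ifs <;> simp_all

theorem norm_zeroOn_crossVector (hp : 0 < p.toReal) (hq : 0 < q.toReal) (hv : 0 ≤ v) :
    ‖zeroOn (crossVector 𝕜 p q m m' u v) Y‖ ^ p.toReal
      = ‖zeroOn (crossVector 𝕜 p q m m' u v) Y 0‖ ^ p.toReal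
        + ((Finset.range m').filter fun j => (j + 1, 0) ∉ Y).card * v ^ p.toReal := by
  rw [lp.norm_rpow_eq_tsum hp, tsum_eq_sum (s := Finset.range (m' + 1)),
    Finset.sum_range_succ', add_comm]
  · congr 1
    rw [Finset.card_filter, Nat.cast_sum, Finset.sum_mul]
    refine Finset.sum_congr rfl fun j hj => ?_
    rw [norm_row_succ_zeroOn_crossVector hq hv]
    have : j < m' := by simpa using hj
    by_cases h : (j + 1, 0) ∈ Y <;> simp [h, this, Real.zero_rpow hp.ne']
  · intro j hj
    obtain _ | j := j
    · simp at hj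
    · rw [norm_row_succ_zeroOn_crossVector hq hv, if_neg, Real.zero_rpow hp.ne']
      rintro ⟨h, -⟩
      simp at hj
      omega

theorem norm_row_zero_zeroOn_crossVector_of_subset (hq : 0 < q.toReal) (hu : 0 ≤ u)
    (hY : Y ⊆ columnIndices m') :
    ‖zeroOn (crossVector 𝕜 p q m m' u v) Y 0‖ = (m : ℝ) ^ (1 / q.toReal) * u := by
  have h := norm_row_zero_zeroOn_crossVector (𝕜 := 𝕜) (p := p) (m := m) (m' := m') (v := v)
    (Y := Y) hq hu
  rw [Finset.filter_true_of_mem (p := fun k => (0, k) ∉ Y)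
      (fun k _ hk => zero_notMem_columnIndices (hY hk)),
    Finset.card_range] at h
  refine (Real.rpow_left_inj (norm_nonneg _) (by positivity) hq.ne').1 ?_
  rw [h, Real.mul_rpow (by positivity) hu, ← Real.rpow_mul (by positivity),
    one_div_mul_cancel hq.ne', Real.rpow_one]

variable [Fact (1 ≤ p)]

theorem norm_zeroOn_rowIndices_crossVector (hp : 0 < p.toReal) (hq : 0 < q.toReal) (hu : 0 ≤ u)
    (hv : 0 ≤ v) :
    ‖zeroOn (crossVector 𝕜 p q m m' u v) (rowIndices m)‖ = (m' : ℝ) ^ (1 / p.toReal) * v := by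
  have h0 : ‖zeroOn (crossVector 𝕜 p q m m' u v) (rowIndices m) 0‖ = 0 := by
    have h := norm_row_zero_zeroOn_crossVector (𝕜 := 𝕜) (p := p) (m := m) (m' := m') (v := v)
      (Y := rowIndices m) hq hu
    rw [Finset.filter_false_of_mem (by simp [zero_mem_rowIndices])] at h
    simp only [Finset.card_empty, Nat.cast_zero, zero_mul] at h
    exact ((Real.rpow_eq_zero_iff_of_nonneg (norm_nonneg _)).1 h).1
  have h1 := norm_zeroOn_crossVector (𝕜 := 𝕜) (m := m) (m' := m') (u := u) (Y := rowIndices m)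
    hp hq hv
  rw [h0, Real.zero_rpow hp.ne', zero_add,
    Finset.filter_true_of_mem (by simp [succ_notMem_rowIndices]), Finset.card_range] at h1
  refine (Real.rpow_left_inj (norm_nonneg _) (by positivity) hp.ne').1 ?_
  rw [h1, Real.mul_rpow (by positivity) hv, ← Real.rpow_mul (by positivity),
    one_div_mul_cancel hp.ne', Real.rpow_one]

theorem norm_zeroOn_columnIndices_crossVector (hp : 0 < p.toReal) (hq : 0 < q.toReal)
    (hu : 0 ≤ u) (hv : 0 ≤ v) :
    ‖zeroOn (crossVector 𝕜 p q m m' u v) (columnIndices m')‖ = (m : ℝ) ^ (1 / q.toReal) * u := by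
  have h1 := norm_zeroOn_crossVector (𝕜 := 𝕜) (m := m) (m' := m') (u := u)
    (Y := columnIndices m') hp hq hv
  rw [Finset.filter_false_of_mem (fun j hj h =>
      h (succ_mem_columnIndices.2 ⟨by simpa using hj, rfl⟩)),
    Finset.card_empty, Nat.cast_zero, zero_mul, add_zero] at h1
  rw [← norm_row_zero_zeroOn_crossVector_of_subset (𝕜 := 𝕜) (p := p) (v := v) hq hu
    (subset_refl (columnIndices m'))]
  exact (Real.rpow_left_inj (norm_nonneg _) (norm_nonneg _) hp.ne').1 h1

end Cross

/-! ### The lower bound on the number of steps -/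

section Converse

variable {𝕜 : Type*} [RCLike 𝕜] {p q : ℝ≥0∞} [Fact (1 ≤ q)] [Fact (1 ≤ p)]

/-- For `p ≤ q`: a row of `N` equal entries of norm one, hidden behind a column of small norm whose
entries have slightly larger weight. -/
theorem lower_bound_of_le (hp : 1 < p.toReal) (hq : 1 < q.toReal) (hpq : p.toReal ≤ q.toReal)
    {C : ℝ} (hC : 0 < C) {τ : ℝ} (hτ : τ ≤ 1) {ψ : ℕ → ℕ}
    (hL : WCGALebesgueInequality 𝕜 (canonicalBasis 𝕜 p q) τ C ψ) {N : ℕ} (hN : 1 ≤ N) :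
    (4 * C) ^ (-p.toReal) * (N : ℝ) ^ wcgaExponent p q ≤ ψ N := by
  set P := p.toReal with hP
  set Q := q.toReal with hQ
  have hN0 : (0 : ℝ) < N := by exact_mod_cast hN
  have hβ : wcgaExponent p q = (P / (P - 1)) / (Q / (Q - 1)) := by
    rw [wcgaExponent_eq hp hq, min_eq_left hpq, max_eq_right hpq]; rfl
  set β := wcgaExponent p q with hβdef
  have hP1 : 0 < P - 1 := by linarith
  have hQ1 : 0 < Q - 1 := by linarith
  have hP0 : 0 < P := by linarith
  have hQ0 : 0 < Q := by linarith
  -- `u` gives the row norm one; `v` makes the weight `v ^ (P - 1)` of the column entries exceed the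
  -- weight `u ^ (Q - 1)` of the row entries by a factor; `n` keeps the column norm below `1 / C`.
  set n := ⌊(4 * C) ^ (-P) * (N : ℝ) ^ β⌋₊ with hn
  set u : ℝ := (N : ℝ) ^ (-(1 / Q)) with hu
  set v : ℝ := 2 * (N : ℝ) ^ (-(β / P)) with hv
  have hu0 : 0 < u := by positivity
  have hv0 : 0 < v := by positivity
  have hrow : (N : ℝ) ^ (1 / Q) * u = 1 := by
    rw [hu, ← Real.rpow_add hN0, add_neg_cancel, Real.rpow_zero]
  have huv : u ^ (Q - 1) < v ^ (P - 1) := by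
    rw [hu, hv, Real.mul_rpow (by norm_num) (by positivity), ← Real.rpow_mul hN0.le,
      ← Real.rpow_mul hN0.le]
    have h1 : -(β / P) * (P - 1) = -(1 / Q) * (Q - 1) := by
      rw [hβ]; field_simp
    rw [h1]
    exact lt_mul_of_one_lt_left (by positivity) (Real.one_lt_rpow (by norm_num) hP1)
  have hsmall : C * ((n : ℝ) ^ (1 / P) * v) < 1 := by
    have h1 : (n : ℝ) ≤ (4 * C) ^ (-P) * (N : ℝ) ^ β := Nat.floor_le (by positivity)
    have h2 : (n : ℝ) ^ (1 / P) ≤ (4 * C)⁻¹ * (N : ℝ) ^ (β / P) := by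
      refine (Real.rpow_le_rpow (by positivity) h1 (by positivity)).trans (le_of_eq ?_)
      rw [Real.mul_rpow (by positivity) (by positivity), ← Real.rpow_mul (by positivity),
        ← Real.rpow_mul hN0.le]
      have h3 : -P * (1 / P) = -1 := by field_simp
      rw [h3, Real.rpow_neg_one, mul_one_div]
    calc C * ((n : ℝ) ^ (1 / P) * v) ≤ C * (((4 * C)⁻¹ * (N : ℝ) ^ (β / P)) * v) := by gcongr
      _ = 1 / 2 := by
        rw [hv, Real.rpow_neg hN0.le]
        field_simp
        norm_num
      _ < 1 := by norm_num
  have key : n < ψ N := by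
    refine lt_of_wcgaLebesgueInequality hp hq hτ hC hL hN
      (f := crossVector 𝕜 p q N n u v) (S := rowIndices N ∪ columnIndices n)
      (B := rowIndices N) (J := columnIndices n)
      (fun e he => coord_crossVector_eq_zero he) (card_rowIndices N).le ?_ ?_
    · rw [norm_zeroOn_rowIndices_crossVector hP0 hQ0 hu0.le hv0.le,
        norm_zeroOn_columnIndices_crossVector hP0 hQ0 hu0.le hv0.le, hrow]
      exact hsmall
    · intro Y hY hYn
      obtain ⟨e, heJ, heY⟩ : ∃ e ∈ columnIndices n, e ∉ Y := by
        by_contra! h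
        have := Finset.card_le_card (show columnIndices n ⊆ Y from h)
        rw [card_columnIndices] at this
        omega
      refine ⟨e, fun b hb => ?_⟩
      obtain ⟨_ | j, k⟩ := e
      · exact absurd heJ zero_notMem_columnIndices
      obtain ⟨hj, rfl⟩ := succ_mem_columnIndices.1 heJ
      have hw : greedyWeight (zeroOn (crossVector 𝕜 p q N n u v) Y) (j + 1, 0)
          = v ^ (P - 1) := by
        rw [greedyWeight, norm_row_succ_zeroOn_crossVector hQ0 hv0.le, if_pos ⟨hj, heY⟩,
          coord_zeroOn, if_neg heY, coord_crossVector_succ, if_pos ⟨hj, rfl⟩, RCLike.norm_ofReal,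
          abs_of_pos hv0, ← Real.rpow_add hv0]
        congr 1; ring
      rw [hw]
      have hzero : (0 : ℝ) ^ (Q - 1) = 0 := Real.zero_rpow hQ1.ne'
      have hvP : 0 < v ^ (P - 1) := by positivity
      obtain ⟨_ | j', k'⟩ := b
      · rw [greedyWeight, norm_row_zero_zeroOn_crossVector_of_subset hQ0 hu0.le hY, hrow,
          Real.one_rpow, one_mul, coord_zeroOn, coord_crossVector_zero]
        split_ifs
        · rwa [norm_zero, hzero]
        · rwa [RCLike.norm_ofReal, abs_of_pos hu0]
        · rwa [norm_zero, hzero]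
      · rw [succ_mem_columnIndices] at hb
        rw [greedyWeight, coord_zeroOn, coord_crossVector_succ, if_neg hb, ite_self, norm_zero,
          hzero, mul_zero]
        exact hvP
  have h1 := Nat.lt_floor_add_one ((4 * C) ^ (-P) * (N : ℝ) ^ β)
  have h2 : ((n : ℝ) + 1) ≤ ψ N := by exact_mod_cast key
  rw [← hn] at h1
  linarith

/-- For `q ≤ p`: a column of `N` equal entries of norm one, hidden behind a row of small norm. As
removing entries of the row lowers the weight of the remaining ones, the row has `2 n` entries, of
which only `n` are guaranteed to be selected first. -/
theorem lower_bound_of_ge (hp : 1 < p.toReal) (hq : 1 < q.toReal) (hpq : q.toReal ≤ p.toReal)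
    {C : ℝ} (hC : 0 < C) {τ : ℝ} (hτ : τ ≤ 1) {ψ : ℕ → ℕ}
    (hL : WCGALebesgueInequality 𝕜 (canonicalBasis 𝕜 p q) τ C ψ) {N : ℕ} (hN : 1 ≤ N) :
    ((4 * C)⁻¹ ^ (p.toReal - 1) / 2) ^ (q.toReal / (q.toReal - 1)) *
      (N : ℝ) ^ wcgaExponent p q ≤ ψ N := by
  set P := p.toReal with hP
  set Q := q.toReal with hQ
  have hN0 : (0 : ℝ) < N := by exact_mod_cast hN
  have hβ : wcgaExponent p q = (Q / (Q - 1)) / (P / (P - 1)) := by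
    rw [wcgaExponent_eq hp hq, min_eq_right hpq, max_eq_left hpq]; rfl
  set β := wcgaExponent p q with hβdef
  have hP1 : 0 < P - 1 := by linarith
  have hQ1 : 0 < Q - 1 := by linarith
  have hP0 : 0 < P := by linarith
  have hQ0 : 0 < Q := by linarith
  set δ : ℝ := (4 * C)⁻¹ with hδ
  have hδ0 : 0 < δ := by positivity
  set c := (δ ^ (P - 1) / 2) ^ (Q / (Q - 1)) with hc
  -- `v` gives the column norm one, and `n` entries `u` have norm `δ`; the bound on `n` makes the
  -- weights in a row of norm at least `δ` exceed the weight `v ^ (P - 1)` of the column entries.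
  set n := ⌊c * (N : ℝ) ^ β⌋₊ with hn
  set u : ℝ := δ * (n : ℝ) ^ (-(1 / Q)) with hu
  set v : ℝ := (N : ℝ) ^ (-(1 / P)) with hv
  have hu0 : 0 ≤ u := by positivity
  have hv0 : 0 < v := by positivity
  have hcol : (N : ℝ) ^ (1 / P) * v = 1 := by
    rw [hv, ← Real.rpow_add hN0, add_neg_cancel, Real.rpow_zero]
  have hsmall : C * (((2 * n : ℕ) : ℝ) ^ (1 / Q) * u) < 1 := by
    rcases Nat.eq_zero_or_pos n with h0 | h0
    · rw [h0, mul_zero, Nat.cast_zero, Real.zero_rpow (by positivity), zero_mul, mul_zero]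
      exact one_pos
    · have hn0 : (0 : ℝ) < n := by exact_mod_cast h0
      have h2 : (2 : ℝ) ^ (1 / Q) ≤ 2 := by
        have := Real.rpow_le_rpow_of_exponent_le (x := 2) (by norm_num)
          ((div_le_one hQ0).2 hq.le : 1 / Q ≤ 1)
        simpa using this
      have h3 : ((2 * n : ℕ) : ℝ) ^ (1 / Q) * u = (2 : ℝ) ^ (1 / Q) * δ := by
        rw [hu, Real.rpow_neg hn0.le]
        push_cast
        rw [Real.mul_rpow (by norm_num) hn0.le]
        field_simp
      rw [h3]
      calc C * ((2 : ℝ) ^ (1 / Q) * δ) ≤ C * (2 * δ) := by gcongr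
        _ = 1 / 2 := by rw [hδ]; field_simp; norm_num
        _ < 1 := by norm_num
  have key : n < ψ N := by
    refine lt_of_wcgaLebesgueInequality hp hq hτ hC hL hN
      (f := crossVector 𝕜 p q (2 * n) N u v) (S := rowIndices (2 * n) ∪ columnIndices N)
      (B := columnIndices N) (J := rowIndices (2 * n))
      (fun e he => coord_crossVector_eq_zero he) (card_columnIndices N).le ?_ ?_
    · rw [norm_zeroOn_rowIndices_crossVector hP0 hQ0 hu0 hv0.le,
        norm_zeroOn_columnIndices_crossVector hP0 hQ0 hu0 hv0.le, hcol]
      exact hsmall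
    · intro Y hY hYn
      have hn0 : (0 : ℝ) < n := by exact_mod_cast (Nat.zero_le _).trans_lt hYn
      have hu1 : 0 < u := by positivity
      obtain ⟨e, heJ, heY⟩ : ∃ e ∈ rowIndices (2 * n), e ∉ Y := by
        by_contra! h
        have := Finset.card_le_card (show rowIndices (2 * n) ⊆ Y from h)
        rw [card_rowIndices] at this
        omega
      refine ⟨e, fun b hb => ?_⟩
      obtain ⟨_ | j, k⟩ := e
      swap
      · exact absurd heJ succ_notMem_rowIndices
      have hk := zero_mem_rowIndices.1 heJ
      -- At least `n` entries of the row remain, so its norm is still at least `δ`.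
      have hrow : δ ≤ ‖zeroOn (crossVector 𝕜 p q (2 * n) N u v) Y 0‖ := by
        have h1 := norm_row_zero_zeroOn_crossVector (𝕜 := 𝕜) (p := p) (m := 2 * n) (m' := N)
          (v := v) (Y := Y) hQ0 hu0
        have h2 : n ≤ ((Finset.range (2 * n)).filter fun k => (0, k) ∉ Y).card := by
          have h3 := Finset.card_filter_add_card_filter_not (s := Finset.range (2 * n))
            (fun k => (0, k) ∈ Y)
          have h4 : ((Finset.range (2 * n)).filter fun k => (0, k) ∈ Y).card ≤ Y.card :=
            Finset.card_le_card_of_injOn (fun k => (0, k))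
              (fun k hk => (Finset.mem_filter.1 hk).2) (by intro a _ b _; simp)
          rw [Finset.card_range] at h3
          omega
        have h5 : δ ^ Q ≤ ‖zeroOn (crossVector 𝕜 p q (2 * n) N u v) Y 0‖ ^ Q := by
          rw [h1]
          calc δ ^ Q = n * u ^ Q := by
                rw [hu, Real.mul_rpow hδ0.le (by positivity), ← Real.rpow_mul hn0.le,
                  neg_mul, one_div_mul_cancel hQ0.ne', Real.rpow_neg_one]
                field_simp
            _ ≤ _ := by gcongr
        by_contra! hlt
        exact absurd h5 (not_le.2 (Real.rpow_lt_rpow (norm_nonneg _) hlt hQ0))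
      have hw : v ^ (P - 1) < greedyWeight (zeroOn (crossVector 𝕜 p q (2 * n) N u v) Y) (0, k) := by
        rw [greedyWeight, coord_zeroOn, if_neg heY, coord_crossVector_zero, if_pos hk,
          RCLike.norm_ofReal, abs_of_pos hu1]
        have h1 : (n : ℝ) ≤ c * (N : ℝ) ^ β := Nat.floor_le (by positivity)
        have h2 : (n : ℝ) ^ ((Q - 1) / Q) ≤ δ ^ (P - 1) / 2 * (N : ℝ) ^ ((P - 1) / P) := by
          refine (Real.rpow_le_rpow hn0.le h1 (by positivity)).trans (le_of_eq ?_)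
          rw [Real.mul_rpow (by positivity) (by positivity), hc, ← Real.rpow_mul (by positivity),
            ← Real.rpow_mul hN0.le]
          have h3 : Q / (Q - 1) * ((Q - 1) / Q) = 1 := by field_simp
          have h4 : β * ((Q - 1) / Q) = (P - 1) / P := by rw [hβ]; field_simp
          rw [h3, h4, Real.rpow_one]
        have h5 : v ^ (P - 1) = ((N : ℝ) ^ ((P - 1) / P))⁻¹ := by
          rw [hv, ← Real.rpow_mul hN0.le, ← Real.rpow_neg hN0.le]
          congr 1; field_simp
        have h6 : u ^ (Q - 1) = δ ^ (Q - 1) * ((n : ℝ) ^ ((Q - 1) / Q))⁻¹ := by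
          rw [hu, Real.mul_rpow hδ0.le (by positivity), ← Real.rpow_mul hn0.le,
            ← Real.rpow_neg hn0.le]
          congr 2; field_simp
        have h7 : δ ^ (P - 1) = δ ^ (P - Q) * δ ^ (Q - 1) := by
          rw [← Real.rpow_add hδ0]; congr 1; ring
        calc v ^ (P - 1) < 2 * ((N : ℝ) ^ ((P - 1) / P))⁻¹ := by
              rw [h5]; exact lt_mul_of_one_lt_left (by positivity) one_lt_two
          _ = δ ^ (P - 1) * (δ ^ (P - 1) / 2 * (N : ℝ) ^ ((P - 1) / P))⁻¹ := by field_simp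
          _ ≤ δ ^ (P - 1) * ((n : ℝ) ^ ((Q - 1) / Q))⁻¹ := by gcongr
          _ = δ ^ (P - Q) * u ^ (Q - 1) := by rw [h6, h7]; ring
          _ ≤ _ := by
              have : 0 ≤ P - Q := by linarith
              gcongr
      refine lt_of_le_of_lt ?_ hw
      have hzero : (0 : ℝ) ^ (Q - 1) = 0 := Real.zero_rpow hQ1.ne'
      have hvP : 0 ≤ v ^ (P - 1) := by positivity
      obtain ⟨_ | j', k'⟩ := b
      · rw [zero_mem_rowIndices] at hb
        rw [greedyWeight, coord_zeroOn, coord_crossVector_zero, if_neg hb, ite_self, norm_zero,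
          hzero, mul_zero]
        exact hvP
      · have hbY : ∀ k, (j' + 1, k) ∉ Y := fun k h => succ_notMem_rowIndices (hY h)
        rw [greedyWeight, coord_zeroOn, if_neg (hbY _), coord_crossVector_succ]
        split_ifs with hj
        · rw [norm_row_succ_zeroOn_crossVector hQ0 hv0.le, if_pos ⟨hj.1, hbY 0⟩,
            RCLike.norm_ofReal, abs_of_pos hv0, ← Real.rpow_add hv0]
          apply le_of_eq
          congr 1; ring
        · rw [norm_zero, hzero, mul_zero]
          exact hvP
  have h1 := Nat.lt_floor_add_one (c * (N : ℝ) ^ β)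
  have h2 : ((n : ℝ) + 1) ≤ ψ N := by exact_mod_cast key
  rw [← hn] at h1
  linarith

end Converse

theorem mainTheorem2 (𝕜 : Type*) [RCLike 𝕜] :
    (∃ C : ℝ, 1 ≤ C ∧
      ∀ (p q : ℝ≥0∞) [Fact (1 ≤ p)] [Fact (1 ≤ q)], 1 < p → p < ∞ → 1 < q → q < ∞ →
      ∀ τ : ℝ, 0 < τ → τ ≤ 1 →
        ∃ c : ℝ, 0 < c ∧
          WCGALebesgueInequality 𝕜 (canonicalBasis 𝕜 p q) τ C
            (fun N => ⌊c * (N : ℝ) ^ wcgaExponent p q⌋₊)) ∧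
    (∀ (p q : ℝ≥0∞) [Fact (1 ≤ p)] [Fact (1 ≤ q)], 1 < p → p < ∞ → 1 < q → q < ∞ →
      ∀ C : ℝ, 0 < C →
        ∃ c' : ℝ, 0 < c' ∧
          ∀ τ : ℝ, 0 < τ → τ ≤ 1 → ∀ ψ : ℕ → ℕ,
            WCGALebesgueInequality 𝕜 (canonicalBasis 𝕜 p q) τ C ψ →
              ∀ N : ℕ, 1 ≤ N → c' * (N : ℝ) ^ wcgaExponent p q ≤ (ψ N : ℝ)) := by
  have htoReal : ∀ p : ℝ≥0∞, 1 < p → p < ∞ → 1 < p.toReal := fun p h1 h2 => by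
    simpa using (ENNReal.toReal_lt_toReal ENNReal.one_ne_top h2.ne).2 h1
  constructor
  · refine ⟨4, by norm_num, ?_⟩
    intro p q _ _ hp hp' hq hq' τ hτ _
    exact exists_wcgaLebesgueInequality (htoReal p hp hp') (htoReal q hq hq') hτ
  · intro p q _ _ hp hp' hq hq' C hC
    have hP := htoReal p hp hp'
    have hQ := htoReal q hq hq'
    rcases le_total p.toReal q.toReal with h | h
    · exact ⟨(4 * C) ^ (-p.toReal), by positivity, fun τ _ hτ ψ hL N hN =>
        lower_bound_of_le hP hQ h hC hτ hL hN⟩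
    · exact ⟨((4 * C)⁻¹ ^ (p.toReal - 1) / 2) ^ (q.toReal / (q.toReal - 1)), by positivity,
        fun τ _ hτ ψ hL N hN => lower_bound_of_ge hP hQ h hC hτ hL hN⟩
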